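/- **Setting.** Let $X$ be a compact non-positively curved cube complex, $G=\pi_1X$, and let $\widetilde X$ be its universal cover (a CAT(0) cube complex), with the combinatorial metric $\mathsf d_{\widetilde X}$. Suppose that every hyperplane $\widetilde U$ of $\widetilde X$ is essential ($\widetilde X$ is not contained in a finite neighbourhood of $\widetilde U$). Let $\widetilde U_1,\dots,\widetilde U_m$ represent the $G$-orbits of hyperplanes of $\widetilde X$, and let $H_j=\mathrm{Stab}_G(\widetilde U_j)$ be the fundamental groups of the immersed hyperplanes of $X$. The carrier $N(\widetilde U)$ is the union of the closed cubes that meet $\widetilde U$. Let $G$ act properly and cocompactly by isometries on a $\delta$-hyperbolic geodesic metric space $\Upsilon$ (sides of geodesic triangles lie in the $\delta$-neighbourhood of the union of the other two), such that every $g\ne1$ in $G$ translates along some bi-infinite geodesic of $\Upsilon$ (an axis). Let $f:\widetilde X\to\Upsilon$ be a $G$-equivariant $\lambda$-quasi-isometry: for some constants $\lambda_1,\lambda_2,\epsilon>0$ with $\lambda_1\lambda_2=\lambda$, $$\tfrac1{\lambda_1}\mathsf d_{\widetilde X}(x,y)-\epsilon\le \mathsf d_\Upsilon(f(x),f(y))\le\lambda_2\,\mathsf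 d_{\widetilde X}(x,y)+\epsilon\quad\text{for all }x,y.$$ Fix $p\in\Upsilon$, let the orbit $H_jp$ be $\kappa_j$-quasiconvex, and put $\kappa=\max_j\kappa_j+2\delta$. Let $\|g\|_\Upsilon=\lim_n \mathsf d_\Upsilon(x,g^nx)/n$ be the stable translation length, and let $\mathcal N_J$ denote the closed $J$-neighbourhood. Let $g_1,\dots,g_k\in G$ (representing conjugacy classes) have axes $\widetilde\gamma_i\subset\Upsilon$ and $\widetilde w_i\subset\widetilde X$ (the latter a bi-infinite combinatorial geodesic). Let $\widetilde Y_i=\mathrm{hull}(\widetilde w_i)$ be the smallest convex subcomplex containing $\widetilde w_i$, let $Y_i=\langle g_i\rangle\backslash\widetilde Y_i$, and let $\mathrm{systole}(Y_i)$ be the least length of an essential closed edge path in $Y_i$. For $\beta>0$, the presentation $\langle G:H_1,\dots,H_m\mid g_1,\dots,g_k\rangle$ is $C'(\beta)$ with respect to $(\Upsilon,p,\gamma_1,\dots,\gamma_k)$ if 1. for all $i,j$ and all translates $\widetilde\gamma=h\widetilde\gamma_i$, $\widetilde\gamma'=h'\widetilde\gamma_j$ ($h,h'\in G$) that share no endpoint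 in $\partial\Upsilon$, every segment of $\widetilde\gamma$ with endpoints in $\mathcal N_{2\delta}(\widetilde\gamma')$ has length less than $\beta\|g_i\|_\Upsilon$; 2. for all $i,j$ and all $a\in G$, every segment of $\widetilde\gamma_i$ with endpoints in $\mathcal N_\kappa(aH_jp)$ has length less than $\beta\|g_i\|_\Upsilon$. The cubical presentation $\langle X\mid Y_1,\dots,Y_k\rangle$ is $C'(\alpha)$ if $\operatorname{diam}P<\alpha\cdot\mathrm{systole}(Y_i)$ for every cone-piece or wall-piece $P$ involving $Y_i$. Here a cone-piece between $Y_i$ and $Y_j$ is a component of $h\widetilde Y_i\cap h'\widetilde Y_j$ with $h,h'\in G$ and $h\widetilde Y_i\ne h'\widetilde Y_j$, and a wall-piece in $Y_i$ is a non-empty intersection $\widetilde Y_i\cap N(\widetilde U)$ with $\widetilde U$ a hyperplane disjoint from $\widetilde Y_i$. **Proposition 5.5.** For all $\alpha>0$ and $\overline\lambda>\lambda$ there is a constant $M$, depending only on $\alpha,\delta,\kappa,\overline\lambda$, the quasi-isometry constants $\lambda_1,\lambda_2,\epsilon$, and $X$ (with $H_1,\dots,H_m$), such that the following holds. If $\langle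 G:H_1,\dots,H_m\mid g_1,\dots,g_k\rangle$ is $C'(\alpha/\overline\lambda)$ with respect to $(\Upsilon,p,\gamma_1,\dots,\gamma_k)$ and $\|g_i\|_\Upsilon\ge M$ for all $i$, then the cubical presentation $\langle X\mid Y_1,\dots,Y_k\rangle$ is $C'(\alpha)$. Moreover, every hyperplane $U$ of $Y_i$ has a carrier of diameter strictly less than $\alpha\cdot\mathrm{systole}(Y_i)$; indeed $\operatorname{diam}(\widetilde Y_i\cap N(\widetilde U))<\alpha\cdot\mathrm{systole}(Y_i)$ for every hyperplane $\widetilde U$ of $\widetilde X$ that meets $\widetilde Y_i$. -/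

import Mathlib

open Filter Topology
open scoped Pointwise

universe u v w

/-! ### Cube complexes, given by the vertex sets of their cubes -/

/-- The faces of the combinatorial `n`-cube `{0,1}ⁿ`: fix some coordinates (`φ i = some b`) and leave
the others free (`φ i = none`). -/
def cubeFace {n : ℕ} (φ : Fin n → Option Bool) : Set (Fin n → Bool) :=
  {x | ∀ i b, φ i = some b → x i = b}

/-- A cube complex in which cubes are embedded and two cubes meet in at most one common face (such as
every CAT(0) cube complex).  A cube is recorded by its set of vertices. -/
structure CubeComplex (V : Type u) where
  /-- the vertex sets of the (closed) cubes -/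
  cubes : Set (Set V)
  /-- every vertex is a `0`-cube -/
  vertex_mem : ∀ x : V, {x} ∈ cubes
  /-- every cube is a combinatorial `n`-cube for some `n`, and the cubes contained in it are exactly
  its faces -/
  isCube : ∀ C ∈ cubes, ∃ (n : ℕ) (c : (Fin n → Bool) → V), Function.Injective c ∧ Set.range c = C ∧
    ∀ F : Set V, F ⊆ C → (F ∈ cubes ↔ ∃ φ : Fin n → Option Bool, F = c '' cubeFace φ)
  /-- two cubes that meet, meet in a common face -/
  inter_mem : ∀ C ∈ cubes, ∀ D ∈ cubes, (C ∩ D).Nonempty → C ∩ D ∈ cubes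

namespace CubeComplex

variable {V : Type u} (T : CubeComplex V)

/-- The `1`-skeleton. The combinatorial metric on the vertices is `T.graph.dist`. -/
def graph : SimpleGraph V where
  Adj x y := x ≠ y ∧ ({x, y} : Set V) ∈ T.cubes
  symm := ⟨fun x y h => ⟨h.1.symm, by rw [Set.pair_comm]; exact h.2⟩⟩
  loopless := ⟨fun _ h => h.1 rfl⟩

/-- `a, b, c, d` are, in this cyclic order, the corners of a `2`-cube. -/
def IsSquare (a b c d : V) : Prop :=
  ({a, b, c, d} : Set V) ∈ T.cubes ∧
    T.graph.Adj a b ∧ T.graph.Adj b c ∧ T.graph.Adj c d ∧ T.graph.Adj d a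

/-- Homotopy of edge paths relative to the endpoints: generated by deleting (or inserting) backtracks
and by pushing a path across a `2`-cube. -/
inductive Homotopic : ∀ {x y : V}, T.graph.Walk x y → T.graph.Walk x y → Prop
  | refl {x y : V} (p : T.graph.Walk x y) : Homotopic p p
  | symm {x y : V} {p q : T.graph.Walk x y} : Homotopic p q → Homotopic q p
  | trans {x y : V} {p q r : T.graph.Walk x y} : Homotopic p q → Homotopic q r → Homotopic p r
  | backtrack {x y a b : V} (p : T.graph.Walk x a) (hab : T.graph.Adj a b) (hba : T.graph.Adj b a)
      (q : T.graph.Walk a y) :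
      Homotopic (p.append (.cons hab (.cons hba q))) (p.append q)
  | square {x y a b c d : V} (p : T.graph.Walk x a) (hab : T.graph.Adj a b) (hbc : T.graph.Adj b c)
      (had : T.graph.Adj a d) (hdc : T.graph.Adj d c) (q : T.graph.Walk c y)
      (hsq : T.IsSquare a b c d) :
      Homotopic (p.append (.cons hab (.cons hbc q))) (p.append (.cons had (.cons hdc q)))

/-- Connected with trivial (edge-path) fundamental group. -/
def SimplyConnected : Prop :=
  T.graph.Connected ∧ ∀ (x y : V) (p q : T.graph.Walk x y), T.Homotopic p q

/-- Non-positive curvature (Gromov's link condition): the link of every vertex `x` is a flag complex,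
i.e. finitely many edges at `x` that pairwise lie in a common cube all lie in a common cube. -/
def NonPositivelyCurved : Prop :=
  ∀ (x : V) (S : Set V), S.Finite → (∀ a ∈ S, T.graph.Adj x a) →
    (∀ a ∈ S, ∀ b ∈ S, ∃ C ∈ T.cubes, x ∈ C ∧ a ∈ C ∧ b ∈ C) →
    ∃ C ∈ T.cubes, x ∈ C ∧ S ⊆ C

/-- A CAT(0) cube complex: simply connected and non-positively curved. -/
def IsCAT0 : Prop := T.SimplyConnected ∧ T.NonPositivelyCurved

/-- `G` acts on `T` by automorphisms, freely (no non-trivial element maps a cube onto itself) and with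
finitely many orbits of cubes.  For `T` a CAT(0) cube complex this says exactly that
`X = G \ T` is a compact non-positively curved cube complex with universal cover `T` and that
`G = π₁ X` acts by deck transformations. -/
structure IsDeckAction (G : Type v) [Group G] [MulAction G V] : Prop where
  smul_mem : ∀ (g : G), ∀ C ∈ T.cubes, g • C ∈ T.cubes
  free : ∀ (g : G), ∀ C ∈ T.cubes, g • C = C → g = 1
  cocompact : ∃ S : Set (Set V), S.Finite ∧ ∀ C ∈ T.cubes, ∃ g : G, ∃ D ∈ S, g • D = C

/-! ### Hyperplanes, carriers, convex hulls -/

/-- Two edges that are opposite in a `2`-cube. -/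
def Opposite (e f : Sym2 V) : Prop :=
  ∃ a b c d : V, T.IsSquare a b c d ∧ e = s(a, b) ∧ f = s(d, c)

/-- A hyperplane, recorded as the set of edges dual to it: a class of the equivalence relation on
edges generated by being opposite in a `2`-cube. -/
def IsHyperplane (U : Set (Sym2 V)) : Prop :=
  ∃ e ∈ T.graph.edgeSet, U = {f | Relation.EqvGen T.Opposite e f}

/-- Vertices of the carrier `N(U)`, the union of the closed cubes that meet `U`.  Every vertex of a cube
that meets `U` is an endpoint of an edge of this cube dual to `U`. -/
def carrier (U : Set (Sym2 V)) : Set V := {x | ∃ e ∈ U, x ∈ e}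

/-- `U` meets the full subcomplex with vertex set `Y`: some edge of the subcomplex is dual to `U`. -/
def Meets (U : Set (Sym2 V)) (Y : Set V) : Prop := ∃ a ∈ Y, ∃ b ∈ Y, s(a, b) ∈ U

/-- `U` is essential: the complex is not contained in a finite neighbourhood of `U`. -/
def Essential (U : Set (Sym2 V)) : Prop :=
  ∀ R : ℕ, ∃ x : V, ∀ y ∈ carrier U, R < T.graph.dist x y

/-- The image of a hyperplane under `g`. -/
def translate {G : Type v} [Group G] [MulAction G V] (g : G) (U : Set (Sym2 V)) : Set (Sym2 V) :=
  Sym2.map (fun x => g • x) '' U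

/-- The stabilizer of a hyperplane of the universal cover; it is the fundamental group of the
corresponding immersed hyperplane of `X = G \ T`. -/
def hyperplaneStabilizer (G : Type v) [Group G] [MulAction G V] (U : Set (Sym2 V)) :
    Subgroup G where
  carrier := {h | translate h U = U}
  one_mem' := by simp [translate]
  mul_mem' := by
    intro a b ha hb
    have key : translate (a * b) U = translate a (translate b U) := by
      simp only [translate, Set.image_image, Sym2.map_map]
      refine Set.image_congr fun e _ => ?_
      congr 1
      funext x
      simp [mul_smul]
    simp only [Set.mem_ofPred_eq] at ha hb ⊢
    rw [key, hb, ha]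
  inv_mem' := by
    intro a ha
    simp only [Set.mem_ofPred_eq] at ha ⊢
    conv_lhs => rw [← ha]
    simp only [translate, Set.image_image, Sym2.map_map]
    simp

/-- Convexity of a full subcomplex (given by its vertices): it contains all combinatorial geodesics
between its vertices. -/
def IsConvex (S : Set V) : Prop :=
  ∀ x ∈ S, ∀ y ∈ S, ∀ z, T.graph.dist x z + T.graph.dist z y = T.graph.dist x y → z ∈ S

/-- The convex hull: the smallest convex subcomplex containing `S`. -/
def hull (S : Set V) : Set V := ⋂₀ {K | T.IsConvex K ∧ S ⊆ K}

/-- `w` is a bi-infinite combinatorial geodesic along which `g` translates (an axis for `g`). -/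
def IsAxis {G : Type v} [Group G] [MulAction G V] (g : G) (w : ℤ → V) : Prop :=
  (∀ m n : ℤ, (T.graph.dist (w m) (w n) : ℤ) = |m - n|) ∧
    ∃ τ : ℤ, τ ≠ 0 ∧ ∀ n, g • w n = w (n + τ)

/-! ### Cubical small cancellation -/

/-- `diam P < r` for the combinatorial metric. -/
def DiamLT (P : Set V) (r : ℝ) : Prop :=
  ∃ D : ℝ, D < r ∧ ∀ x ∈ P, ∀ y ∈ P, (T.graph.dist x y : ℝ) ≤ D

/-- `P` is (the vertex set of) a connected component of the full subcomplex with vertex set `S`. -/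
def IsComponent (S P : Set V) : Prop :=
  ∃ x : S, P = {y | ∃ hy : y ∈ S, (T.graph.induce S).Reachable x ⟨y, hy⟩}

variable {G : Type v} [Group G] [MulAction G V]

/-- The systole of `Y = ⟨g⟩ \ Ỹ`, for a convex `⟨g⟩`-invariant subcomplex `Ỹ` and `g` of infinite
order: the least length of an essential closed edge path in `Y`. Such a closed path lifts to a path
from a vertex `y` of `Ỹ` to `gⁿ y` with `n ≠ 0`. -/
noncomputable def systole (g : G) (Y : Set V) : ℕ :=
  sInf {ℓ : ℕ | ∃ y ∈ Y, ∃ n : ℤ, n ≠ 0 ∧ ℓ = T.graph.dist y (g ^ n • y)}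

/-- `P` is a cone-piece between `⟨·⟩ \ Y` and `⟨·⟩ \ Y'`: a component of the intersection of two
lifts (translates) of `Y` and `Y'`, the case of equal lifts being excluded. -/
def IsConePiece (G : Type v) [Group G] [MulAction G V] (Y Y' P : Set V) : Prop :=
  ∃ h h' : G, h • Y ≠ h' • Y' ∧ T.IsComponent ((h • Y) ∩ (h' • Y')) P

/-- `P` is a wall-piece in `⟨·⟩ \ Y`: a non-empty intersection of `Y` with the carrier of a
hyperplane that is disjoint from `Y`. -/
def IsWallPiece (Y P : Set V) : Prop :=
  ∃ U, T.IsHyperplane U ∧ ¬ Meets U Y ∧ P = Y ∩ carrier U ∧ P.Nonempty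

/-- The `C'(α)` condition for the cubical presentation `⟨X ∣ Y₁, …, Y_k⟩` with `X = G \ T` and
`Y_i = ⟨g i⟩ \ Y i`: every cone-piece or wall-piece `P` involving `Y_i` has
`diam P < α · systole(Y_i)`. -/
structure SmallCancellation {k : ℕ} (g : Fin k → G) (Y : Fin k → Set V) (α : ℝ) : Prop where
  conePiece : ∀ i j P, T.IsConePiece G (Y i) (Y j) P →
    T.DiamLT P (α * T.systole (g i) (Y i)) ∧ T.DiamLT P (α * T.systole (g j) (Y j))
  wallPiece : ∀ i P, T.IsWallPiece (Y i) P → T.DiamLT P (α * T.systole (g i) (Y i))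

end CubeComplex

/-! ### Hyperbolic geodesic metric spaces -/

section MetricGeometry

variable {Υ : Type w} [MetricSpace Υ]

/-- `A` is a geodesic segment from `x` to `y`. -/
def IsGeodesicSegment (A : Set Υ) (x y : Υ) : Prop :=
  ∃ c : ℝ → Υ, c 0 = x ∧ c (dist x y) = y ∧
    (∀ s ∈ Set.Icc 0 (dist x y), ∀ t ∈ Set.Icc 0 (dist x y), dist (c s) (c t) = |s - t|) ∧
    A = c '' Set.Icc 0 (dist x y)

/-- Any two points are joined by a geodesic segment. -/
def IsGeodesicSpace (Υ : Type w) [MetricSpace Υ] : Prop :=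
  ∀ x y : Υ, ∃ A, IsGeodesicSegment A x y

/-- `δ`-hyperbolicity: each side of a geodesic triangle lies in the `δ`-neighbourhood of the union of
the other two sides. -/
def IsHyperbolicSpace (Υ : Type w) [MetricSpace Υ] (δ : ℝ) : Prop :=
  ∀ (x y z : Υ) (A B C : Set Υ), IsGeodesicSegment A x y → IsGeodesicSegment B y z →
    IsGeodesicSegment C z x → ∀ a ∈ A, ∃ b ∈ B ∪ C, dist a b ≤ δ

/-- `A` is `κ`-quasiconvex: geodesic segments with endpoints in `A` lie in the closed
`κ`-neighbourhood of `A`. -/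
def IsQuasiconvex (A : Set Υ) (κ : ℝ) : Prop :=
  ∀ x ∈ A, ∀ y ∈ A, ∀ S, IsGeodesicSegment S x y → S ⊆ Metric.cthickening κ A

/-- Two bi-infinite geodesics share an endpoint in the boundary at infinity: a ray of one is
asymptotic to (at bounded distance from) a ray of the other. -/
def SharesEndpoint (γ γ' : ℝ → Υ) : Prop :=
  ∃ s s' : ℝ, (s = 1 ∨ s = -1) ∧ (s' = 1 ∨ s' = -1) ∧
    ∃ B : ℝ, ∀ t : ℝ, 0 ≤ t → dist (γ (s * t)) (γ' (s' * t)) ≤ B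

variable {G : Type v} [Group G] [MulAction G Υ]

/-- The action is (metrically) proper and cocompact. -/
structure IsGeometricAction (G : Type v) (Υ : Type w) [Group G] [MetricSpace Υ] [MulAction G Υ] :
    Prop where
  proper : ∀ (x : Υ) (R : ℝ), {g : G | dist x (g • x) ≤ R}.Finite
  cocompact : ∃ K : Set Υ, IsCompact K ∧ ∀ x : Υ, ∃ g : G, ∃ y ∈ K, g • y = x

/-- `γ` is a bi-infinite geodesic along which `g` translates (a geodesic axis for `g`). -/
def IsGeodesicAxis (g : G) (γ : ℝ → Υ) : Prop :=
  Isometry γ ∧ ∃ τ : ℝ, τ ≠ 0 ∧ ∀ t, g • γ t = γ (t + τ)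

/-- The stable translation length `lim d(x, gⁿ x) / n`. -/
noncomputable def stableTranslationLength (g : G) (x : Υ) : ℝ :=
  limUnder atTop (fun n : ℕ => dist x (g ^ n • x) / n)

/-- The limit defining the stable translation length exists. -/
theorem tendsto_stableTranslationLength [IsIsometricSMul G Υ] (g : G) (x : Υ) :
    Tendsto (fun n : ℕ => dist x (g ^ n • x) / n) atTop (𝓝 (stableTranslationLength g x)) := by
  have hsub : Subadditive (fun n : ℕ => dist x (g ^ n • x)) := by
    intro m n
    calc dist x (g ^ (m + n) • x)
        ≤ dist x (g ^ m • x) + dist (g ^ m • x) (g ^ (m + n) • x) := dist_triangle _ _ _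
      _ = dist x (g ^ m • x) + dist x (g ^ n • x) := by rw [pow_add, mul_smul, dist_smul]
  refine tendsto_nhds_limUnder ⟨_, hsub.tendsto_lim ⟨0, ?_⟩⟩
  rintro _ ⟨n, rfl⟩
  positivity

/-- The presentation `⟨G : H₁, …, H_m ∣ g₁, …, g_k⟩` is `C'(α)` with respect to
`(Υ, p, γ₁, …, γ_k)`.  Here `γ i` is the chosen geodesic axis of `g i`, so that the other preimages of
the closed geodesic are the translates `h • γ i`; `δ` is the hyperbolicity constant, `κ` the looseness
constant for wall-pieces.  A loose piece is a maximal segment of a geodesic with endpoints in a closed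
neighbourhood; so its length is bounded by a number exactly if this holds for all segments with
endpoints in that neighbourhood.  (If there are arbitrarily long ones, then the
condition fails.) -/
structure CubeFreeSmallCancellation {k m : ℕ} (H : Fin m → Subgroup G) (g : Fin k → G)
    (p : Υ) (γ : Fin k → ℝ → Υ) (δ κ α : ℝ) : Prop where
  /-- `2δ`-loose cone-pieces between `γ i` and `γ j`, defined for preimages that do not share an
  endpoint at infinity, are shorter than `α` times the stable translation length of `g i` -/
  conePiece : ∀ i j, ∀ h h' : G,
    ¬ SharesEndpoint (fun t => h • γ i t) (fun t => h' • γ j t) →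
    ∀ s t : ℝ,
      h • γ i s ∈ Metric.cthickening (2 * δ) (Set.range fun r => h' • γ j r) →
      h • γ i t ∈ Metric.cthickening (2 * δ) (Set.range fun r => h' • γ j r) →
      |s - t| < α * stableTranslationLength (g i) p
  /-- `κ`-loose wall-pieces in `γ i` are shorter than `α` times the stable translation length -/
  wallPiece : ∀ i, ∀ (j : Fin m) (a : G), ∀ s t : ℝ,
      γ i s ∈ Metric.cthickening κ {y | ∃ h ∈ H j, y = (a * h) • p} →
      γ i t ∈ Metric.cthickening κ {y | ∃ h ∈ H j, y = (a * h) • p} →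
      |s - t| < α * stableTranslationLength (g i) p

/-- The inequality of a `(λ₁, λ₂, ε)`-quasi-isometry on the vertices of a cube complex with its
combinatorial metric.  A `λ`-quasi-isometry is a map that satisfies it for some positive `λ₁`, `λ₂`, `ε`
with `λ₁ λ₂ = λ`. -/
def IsQuasiIsometryWith {V : Type u} (T : CubeComplex V) (lam₁ lam₂ ε : ℝ) (f : V → Υ) : Prop :=
  ∀ x y : V, 1 / lam₁ * (T.graph.dist x y : ℝ) - ε ≤ dist (f x) (f y) ∧
    dist (f x) (f y) ≤ lam₂ * (T.graph.dist x y : ℝ) + ε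

end MetricGeometry

/-!
The overlap of an axis with another translate of an axis, or with the carrier of a hyperplane, can be
measured in `T` or, after applying the quasi-isometry `f`, in `Υ`; the theorem compares the two.  Let
`Y = hull w` be one of the hulls.

*Cube complex.*  Two geodesics of the 1-skeleton with the same endpoints differ by pushes across squares
(`PathFrom.swapEq_of_geodesic`): reduced edge paths up to such pushes form a covering of the complex,
by the link condition, and so homotopic reduced paths agree up to pushes.  This gives the quadrangle
condition, and with it convex halfspaces that separate points from intervals.  Consequently `Y` is the
union of the intervals between points of `w` (`IsCAT0.mem_hull_line_iff`), and two hulls whose axes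
are translated by a common element are equal or disjoint (`IsCAT0.hull_eq_of_translates`).

*Hyperbolic space.*  The quasi-isometry `f` maps geodesics to quasi-geodesics, which are uniformly close
to geodesics (`exists_quasiGeodesic_near_geodesic`).  So `f(Y)` is uniformly close to the axis `γ` in
`Υ` (`IsCAT0.exists_hull_near_axis`).  The carrier of a hyperplane is bounded, or its image is
uniformly close to geodesics between points of an orbit `a H p`, wherever the basepoint `p` is
(`IsCAT0.exists_carrier_near`).  Geodesics with nearby endpoints are `2δ`-close away from the
endpoints (`IsHyperbolicSpace.overlap_le`), which gives the neighbourhoods `2δ` and `κ` of the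
hypothesis.

*Pieces.*  A cone-piece comes from translates of axes with no common endpoint at infinity, as otherwise
they have a common power by properness (`IsGeometricAction.exists_zpow_eq`) and their hulls coincide.
Hence pieces, and intersections of `Y` with carriers, have diameter at most
`lam₁ (α / lamBar) ‖g‖ + Q` for a constant `Q`, whereas `α · systole ≥ (α / lam₂) ‖g‖`.  Since
`lam₁ lam₂ < lamBar`, the latter is larger once `‖g‖` is large.
-/

/-! ### Squares and 3-cubes -/

/-- Flip the `i`-th coordinate of a vertex of the combinatorial cube. -/
def flipCoord {n : ℕ} (i : Fin n) (x : Fin n → Bool) : Fin n → Bool := Function.update x i (!x i)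

theorem flipCoord_same {n : ℕ} (i : Fin n) (x : Fin n → Bool) : flipCoord i x i = !x i := by
  simp [flipCoord]

theorem flipCoord_ne {n : ℕ} {i k : Fin n} (h : k ≠ i) (x : Fin n → Bool) :
    flipCoord i x k = x k := by
  simp [flipCoord, h]

theorem flipCoord_apply {n : ℕ} (i k : Fin n) (x : Fin n → Bool) :
    flipCoord i x k = if k = i then !x k else x k := by
  by_cases h : k = i
  · subst h; simp [flipCoord]
  · simp [flipCoord, h]

theorem flipCoord_comm {n : ℕ} (i j : Fin n) (x : Fin n → Bool) :
    flipCoord i (flipCoord j x) = flipCoord j (flipCoord i x) := by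
  funext k
  simp only [flipCoord_apply]
  split_ifs <;> rfl

theorem flipCoord_injective {n : ℕ} {i j : Fin n} {x : Fin n → Bool}
    (h : flipCoord i x = flipCoord j x) : i = j := by
  by_contra hij
  have := congrFun h i
  rw [flipCoord_same, flipCoord_ne hij] at this
  simp at this

/-- A vertex of the cube adjacent to two distinct neighbours of `x` is `x` or the opposite corner of
the square they span. -/
theorem flipCoord_flipCoord_eq {n : ℕ} {i j k l : Fin n} {x : Fin n → Bool} (hij : i ≠ j)
    (h : flipCoord k (flipCoord i x) = flipCoord l (flipCoord j x)) :
    flipCoord k (flipCoord i x) = x ∨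
      flipCoord k (flipCoord i x) = flipCoord j (flipCoord i x) := by
  by_cases hki : k = i
  · left
    subst hki
    funext m
    simp only [flipCoord_apply]
    split_ifs <;> simp
  · right
    have h1 := congrFun h k
    simp only [flipCoord_apply, hki, if_false, if_true] at h1
    have hi := congrFun h i
    simp only [flipCoord_apply, Ne.symm hki, hij, if_false, if_true] at hi
    have hil : i = l := by
      by_contra hne
      simp [hne] at hi
    subst hil
    have hkj : k = j := by
      by_contra hne
      simp [hne, hki] at h1
    rw [hkj]

namespace CubeComplex

variable {V : Type u} (T : CubeComplex V)

theorem ncard_cube {C : Set V} (hC : C ∈ T.cubes) : ∃ n : ℕ, C.ncard = 2 ^ n := by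
  obtain ⟨n, c, hinj, rfl, -⟩ := T.isCube C hC
  refine ⟨n, ?_⟩
  rw [← Set.image_univ, Set.ncard_image_of_injective _ hinj, Set.ncard_univ]
  simp [Nat.card_eq_fintype_card]

theorem triple_notMem_cubes {a b c : V} (hab : a ≠ b) (hac : a ≠ c) (hbc : b ≠ c) :
    ({a, b, c} : Set V) ∉ T.cubes := by
  intro h
  obtain ⟨n, hn⟩ := T.ncard_cube h
  rw [Set.ncard_eq_three.2 ⟨a, b, c, hab, hac, hbc, rfl⟩] at hn
  match n, hn with
  | 0, hn => norm_num at hn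
  | n + 1, hn => rw [pow_succ] at hn; omega

/-- A non-degenerate square.  (`IsSquare` also holds for `a, b, a, b` when `a, b` are adjacent.) -/
def IsProperSquare (a b c d : V) : Prop := T.IsSquare a b c d ∧ a ≠ c ∧ b ≠ d

variable {T}

theorem IsSquare.rotate {a b c d : V} (h : T.IsSquare a b c d) : T.IsSquare b c d a := by
  obtain ⟨h1, h2, h3, h4, h5⟩ := h
  refine ⟨?_, h3, h4, h5, h2⟩
  convert h1 using 1
  ext x; simp only [Set.mem_insert_iff, Set.mem_singleton_iff]; tauto

theorem IsSquare.reflect {a b c d : V} (h : T.IsSquare a b c d) : T.IsSquare a d c b := by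
  obtain ⟨h1, h2, h3, h4, h5⟩ := h
  refine ⟨?_, h5.symm, h4.symm, h3.symm, h2.symm⟩
  convert h1 using 1
  ext x; simp only [Set.mem_insert_iff, Set.mem_singleton_iff]; tauto

theorem IsProperSquare.rotate {a b c d : V} (h : T.IsProperSquare a b c d) :
    T.IsProperSquare b c d a :=
  ⟨h.1.rotate, h.2.2, h.2.1.symm⟩

theorem IsProperSquare.reflect {a b c d : V} (h : T.IsProperSquare a b c d) :
    T.IsProperSquare a d c b :=
  ⟨h.1.reflect, h.2.1, h.2.2.symm⟩

theorem IsSquare.proper_or {a b c d : V} (h : T.IsSquare a b c d) :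
    T.IsProperSquare a b c d ∨ (a = c ∧ b = d) := by
  obtain ⟨h1, h2, h3, h4, h5⟩ := id h
  by_cases hac : a = c
  · by_cases hbd : b = d
    · exact Or.inr ⟨hac, hbd⟩
    · exfalso
      subst hac
      refine T.triple_notMem_cubes h2.1 h5.1.symm hbd ?_
      convert h1 using 1
      ext x; simp only [Set.mem_insert_iff, Set.mem_singleton_iff]; tauto
  · by_cases hbd : b = d
    · exfalso
      subst hbd
      refine T.triple_notMem_cubes h2.1 hac h3.1 ?_
      convert h1 using 1
      ext x; simp only [Set.mem_insert_iff, Set.mem_singleton_iff]; tauto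
    · exact Or.inl ⟨h, hac, hbd⟩

/-- A cube that contains three corners of a square contains the fourth. -/
theorem IsProperSquare.mem_of_mem {a b c d : V} (h : T.IsProperSquare a b c d) {C : Set V}
    (hC : C ∈ T.cubes) (ha : a ∈ C) (hb : b ∈ C) (hc : c ∈ C) : d ∈ C := by
  by_contra hd
  have h1 := T.inter_mem _ hC _ h.1.1 ⟨a, ha, by simp⟩
  refine T.triple_notMem_cubes h.1.2.1.1 h.2.1 h.1.2.2.1.1 ?_
  convert h1 using 1
  ext x
  simp only [Set.mem_insert_iff, Set.mem_singleton_iff, Set.mem_inter_iff]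
  constructor
  · rintro (rfl | rfl | rfl) <;> simp [ha, hb, hc]
  · rintro ⟨hx, rfl | rfl | rfl | rfl⟩ <;> simp_all

/-- Three corners of a square determine the fourth. -/
theorem IsProperSquare.corner_unique {a b c d d' : V} (h : T.IsProperSquare a b c d)
    (h' : T.IsProperSquare a b c d') : d = d' := by
  have := h.mem_of_mem h'.1.1 (by simp) (by simp) (by simp)
  simp only [Set.mem_insert_iff, Set.mem_singleton_iff] at this
  rcases this with rfl | rfl | rfl | rfl
  · exact absurd rfl h.1.2.2.2.2.1
  · exact absurd rfl h.2.2
  · exact absurd rfl h.1.2.2.2.1.1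
  · rfl

section Coordinates

variable {n : ℕ} {c : (Fin n → Bool) → V}

theorem exists_flipCoord_of_adj (hinj : Function.Injective c)
    (hface : ∀ F : Set V, F ⊆ Set.range c →
      (F ∈ T.cubes ↔ ∃ φ : Fin n → Option Bool, F = c '' cubeFace φ))
    {x y : Fin n → Bool} (h : T.graph.Adj (c x) (c y)) : ∃ i, y = flipCoord i x := by
  obtain ⟨φ, hφ⟩ := (hface {c x, c y} (by rintro _ (rfl | rfl) <;> simp)).1 h.2
  have hφ' : cubeFace φ = {x, y} := by
    apply hinj.image_injective
    rw [← hφ, Set.image_pair]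
  have hx : x ∈ cubeFace φ := by rw [hφ']; simp
  have hy : y ∈ cubeFace φ := by rw [hφ']; simp
  have hxy : x ≠ y := fun h' => h.1 (by rw [h'])
  obtain ⟨i, hi⟩ := Function.ne_iff.1 hxy
  have hnone : ∀ b, φ i ≠ some b := fun b hb => hi (by rw [hx i b hb, hy i b hb])
  have hmem : flipCoord i x ∈ cubeFace φ := by
    intro k b hb
    have hki : k ≠ i := by rintro rfl; exact hnone b hb
    rw [flipCoord_ne hki]
    exact hx k b hb
  rw [hφ'] at hmem
  rcases hmem with hmem | hmem
  · have := congrFun hmem i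
    rw [flipCoord_same] at this
    simp at this
  · exact ⟨i, hmem.symm⟩

theorem adj_flipCoord (hinj : Function.Injective c)
    (hface : ∀ F : Set V, F ⊆ Set.range c →
      (F ∈ T.cubes ↔ ∃ φ : Fin n → Option Bool, F = c '' cubeFace φ))
    (x : Fin n → Bool) (i : Fin n) : T.graph.Adj (c x) (c (flipCoord i x)) := by
  refine ⟨fun h => ?_, (hface _ (by rintro _ (rfl | rfl) <;> simp)).2
    ⟨fun k => if k = i then none else some (x k), ?_⟩⟩
  · have := congrFun (hinj h) i
    rw [flipCoord_same] at this
    simp at this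
  · rw [← Set.image_pair]
    congr 1
    ext y
    simp only [Set.mem_insert_iff, Set.mem_singleton_iff, cubeFace, Set.mem_ofPred_eq]
    constructor
    · rintro (rfl | rfl) k b hb <;> by_cases hk : k = i <;> simp_all [flipCoord_apply]
    · intro h
      have hne : ∀ k, k ≠ i → y k = x k := fun k hk => h k (x k) (by simp [hk])
      by_cases hy : y i = x i
      · left; funext k
        by_cases hk : k = i
        · rw [hk, hy]
        · exact hne k hk
      · right; funext k
        by_cases hk : k = i
        · subst hk; rw [flipCoord_same]; cases h1 : y k <;> cases h2 : x k <;> simp_all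
        · rw [flipCoord_ne hk]; exact hne k hk

theorem isProperSquare_flipCoord (hinj : Function.Injective c)
    (hface : ∀ F : Set V, F ⊆ Set.range c →
      (F ∈ T.cubes ↔ ∃ φ : Fin n → Option Bool, F = c '' cubeFace φ))
    (x : Fin n → Bool) {i j : Fin n} (hij : i ≠ j) :
    T.IsProperSquare (c x) (c (flipCoord i x)) (c (flipCoord j (flipCoord i x)))
      (c (flipCoord j x)) := by
  have hd : flipCoord j x ≠ flipCoord i x := fun h => hij (flipCoord_injective h).symm
  refine ⟨⟨?_, adj_flipCoord hinj hface _ _, adj_flipCoord hinj hface _ _, ?_,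
    (adj_flipCoord hinj hface _ _).symm⟩, fun h => ?_, fun h => hd (hinj h).symm⟩
  · refine (hface _ (by rintro _ (rfl | rfl | rfl | rfl) <;> simp)).2
      ⟨fun k => if k = i ∨ k = j then none else some (x k), ?_⟩
    rw [← Set.image_singleton, ← Set.image_insert_eq, ← Set.image_insert_eq, ← Set.image_insert_eq]
    congr 1
    ext y
    simp only [Set.mem_insert_iff, Set.mem_singleton_iff, cubeFace, Set.mem_ofPred_eq]
    constructor
    · rintro (rfl | rfl | rfl | rfl) k b hb <;> by_cases hk : k = i <;> by_cases hk' : k = j <;>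
        simp_all [flipCoord_apply]
    · intro h
      have hne : ∀ k, k ≠ i → k ≠ j → y k = x k := fun k hk hk' => h k (x k) (by simp [hk, hk'])
      have key : ∀ z : Fin n → Bool, (∀ k, k ≠ i → k ≠ j → z k = x k) → y i = z i → y j = z j →
          y = z := by
        intro z hz h1 h2
        funext k
        by_cases hk : k = i
        · rw [hk, h1]
        · by_cases hk' : k = j
          · rw [hk', h2]
          · rw [hne k hk hk', hz k hk hk']
      have e1 : y i = x i ∨ y i = !x i := by cases y i <;> cases x i <;> simp
      have e2 : y j = x j ∨ y j = !x j := by cases y j <;> cases x j <;> simp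
      rcases e1 with e1 | e1 <;> rcases e2 with e2 | e2
      · exact Or.inl (key _ (fun _ _ _ => rfl) e1 e2)
      · refine Or.inr (Or.inr (Or.inr (key _ (fun k hk hk' => ?_) ?_ ?_))) <;>
          simp_all [flipCoord_apply]
      · refine Or.inr (Or.inl (key _ (fun k hk hk' => ?_) ?_ ?_)) <;>
          simp_all [flipCoord_apply, Ne.symm hij]
      · refine Or.inr (Or.inr (Or.inl (key _ (fun k hk hk' => ?_) ?_ ?_))) <;>
          simp_all [flipCoord_apply, Ne.symm hij]
  · rw [flipCoord_comm]
    exact (adj_flipCoord hinj hface _ _).symm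
  · have := congrFun (hinj h) i
    rw [flipCoord_ne hij, flipCoord_same] at this
    simp at this

end Coordinates

/-- Three squares that pairwise share an edge at a vertex `v` are faces of a common 3-cube. -/
theorem exists_cube_corner (hN : T.NonPositivelyCurved) {v a b e p r s : V}
    (hp : T.IsProperSquare v a p b) (hr : T.IsProperSquare v b r e)
    (hs : T.IsProperSquare v a s e) :
    ∃ t, T.IsProperSquare a p t s ∧ T.IsProperSquare b p t r ∧ T.IsProperSquare e r t s := by
  obtain ⟨C, hC, hv, hS⟩ := hN v {a, b, e} (by simp)
    (by rintro _ (rfl | rfl | rfl)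
        exacts [hp.1.2.1, hr.1.2.1, hr.1.2.2.2.2.symm])
    (by
      have h1 := hp.1.1
      have h2 := hr.1.1
      have h3 := hs.1.1
      rintro _ (rfl | rfl | rfl) _ (rfl | rfl | rfl)
      all_goals first
        | (refine ⟨_, h1, ?_, ?_, ?_⟩ <;>
            simp only [Set.mem_insert_iff, Set.mem_singleton_iff, true_or, or_true]; done)
        | (refine ⟨_, h2, ?_, ?_, ?_⟩ <;>
            simp only [Set.mem_insert_iff, Set.mem_singleton_iff, true_or, or_true]; done)
        | (refine ⟨_, h3, ?_, ?_, ?_⟩ <;>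
            simp only [Set.mem_insert_iff, Set.mem_singleton_iff, true_or, or_true]))
  have ha : a ∈ C := hS (by simp)
  have hb : b ∈ C := hS (by simp)
  have he : e ∈ C := hS (by simp)
  have hpC : p ∈ C := hp.rotate.rotate.rotate.mem_of_mem hC hb hv ha
  have hrC : r ∈ C := hr.rotate.rotate.rotate.mem_of_mem hC he hv hb
  have hsC : s ∈ C := hs.rotate.rotate.rotate.mem_of_mem hC he hv ha
  obtain ⟨n, c, hinj, rfl, hface⟩ := T.isCube C hC
  obtain ⟨x, rfl⟩ := hv
  obtain ⟨xa, rfl⟩ := ha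
  obtain ⟨xb, rfl⟩ := hb
  obtain ⟨xe, rfl⟩ := he
  obtain ⟨xp, rfl⟩ := hpC
  obtain ⟨xr, rfl⟩ := hrC
  obtain ⟨xs, rfl⟩ := hsC
  obtain ⟨i, rfl⟩ := exists_flipCoord_of_adj hinj hface hp.1.2.1
  obtain ⟨j, rfl⟩ := exists_flipCoord_of_adj hinj hface hr.1.2.1
  obtain ⟨k, rfl⟩ := exists_flipCoord_of_adj hinj hface hr.1.2.2.2.2.symm
  have hij : i ≠ j := by rintro rfl; exact hp.2.2 rfl
  have hjk : j ≠ k := by rintro rfl; exact hr.2.2 rfl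
  have hik : i ≠ k := by rintro rfl; exact hs.2.2 rfl
  have corner : ∀ {i j : Fin n} {y : Fin n → Bool}, i ≠ j →
      T.IsProperSquare (c x) (c (flipCoord i x)) (c y) (c (flipCoord j x)) →
      y = flipCoord j (flipCoord i x) := by
    intro i j y hij h
    obtain ⟨k, rfl⟩ := exists_flipCoord_of_adj hinj hface h.1.2.2.1
    obtain ⟨l, hl⟩ := exists_flipCoord_of_adj hinj hface h.1.2.2.2.1.symm
    rcases flipCoord_flipCoord_eq hij hl with h' | h'
    · exact absurd (by rw [h']) h.2.1
    · exact h'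
  obtain rfl := corner hij hp
  obtain rfl := corner hjk hr
  obtain rfl := corner hik hs
  refine ⟨c (flipCoord k (flipCoord j (flipCoord i x))), ?_, ?_, ?_⟩
  · exact isProperSquare_flipCoord hinj hface _ hjk
  · have := isProperSquare_flipCoord hinj hface (flipCoord j x) hik
    rwa [flipCoord_comm i j] at this
  · have := isProperSquare_flipCoord hinj hface (flipCoord k x) hij.symm
    rwa [flipCoord_comm i k, flipCoord_comm j k, flipCoord_comm i k, flipCoord_comm i j] at this

end CubeComplex

namespace CubeComplex

variable {V : Type u} {T : CubeComplex V}

/-! ### Edge paths up to pushing across squares -/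

variable (T) in
/-- One push of an edge path across a square.  An edge path is recorded by the list of its vertices in
reverse order, so that its last vertex is the head of the list. -/
inductive SwapStep : List V → List V → Prop
  | swap {a b c d : V} (t : List V) :
      T.IsProperSquare a b c d → SwapStep (c :: b :: a :: t) (c :: d :: a :: t)
  | cons (x : V) {p q : List V} : SwapStep p q → SwapStep (x :: p) (x :: q)

variable (T) in
/-- Two edge paths that differ by pushes across squares (no backtracks are removed). -/
def SwapEq : List V → List V → Prop := Relation.ReflTransGen T.SwapStep

theorem SwapStep.symm {p q : List V} (h : T.SwapStep p q) : T.SwapStep q p := by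
  induction h with
  | swap t h => exact .swap t h.reflect
  | cons x _ ih => exact .cons x ih

namespace SwapEq

theorem refl (p : List V) : T.SwapEq p p := Relation.ReflTransGen.refl

theorem symm {p q : List V} (h : T.SwapEq p q) : T.SwapEq q p := by
  induction h with
  | refl => exact .refl _
  | tail _ h2 ih => exact Relation.ReflTransGen.head h2.symm ih

theorem trans {p q r : List V} (h : T.SwapEq p q) (h' : T.SwapEq q r) : T.SwapEq p r :=
  Relation.ReflTransGen.trans h h'

theorem cons (x : V) {p q : List V} (h : T.SwapEq p q) : T.SwapEq (x :: p) (x :: q) := by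
  induction h with
  | refl => exact .refl _
  | tail _ h2 ih => exact ih.tail (.cons x h2)

theorem of_square {a b c d : V} (h : T.IsProperSquare a b c d) (t : List V) :
    T.SwapEq (c :: b :: a :: t) (c :: d :: a :: t) :=
  Relation.ReflTransGen.single (.swap t h)

theorem length_eq {p q : List V} (h : T.SwapEq p q) : p.length = q.length := by
  have step : ∀ {p q : List V}, T.SwapStep p q → p.length = q.length := by
    intro p q h
    induction h with
    | swap t h => simp
    | cons x _ ih => simp [ih]
  induction h with
  | refl => rfl
  | tail _ h2 ih => rw [ih, step h2]

theorem exists_cons {y : V} {r q : List V} (h : T.SwapEq (y :: r) q) : ∃ r', q = y :: r' := by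
  induction h with
  | refl => exact ⟨r, rfl⟩
  | tail _ h2 ih =>
    obtain ⟨r', rfl⟩ := ih
    cases h2 with
    | swap t h => exact ⟨_, rfl⟩
    | cons x h => exact ⟨_, rfl⟩

end SwapEq

theorem SwapStep.exists_cons {y : V} {r q : List V} (h : T.SwapStep (y :: r) q) :
    ∃ r', q = y :: r' :=
  SwapEq.exists_cons (Relation.ReflTransGen.single h)

/-- Exchange property for the last edges of two paths that differ by pushes across squares: either the
last edges agree, and so do the remaining paths up to pushes, or the last edges span a square
through which both paths can be pushed.  The inductive step is the completion of three squares at a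
vertex to a 3-cube. -/
theorem SwapEq.exchange (hN : T.NonPositivelyCurved) {y z : V} {r q : List V}
    (h : T.SwapEq (y :: z :: r) q) :
    ∃ z' r', q = y :: z' :: r' ∧ ((z = z' ∧ T.SwapEq (z :: r) (z' :: r')) ∨
      ∃ x t, T.IsProperSquare x z y z' ∧ T.SwapEq (z :: r) (z :: x :: t) ∧
        T.SwapEq (z' :: r') (z' :: x :: t)) := by
  induction hn : r.length generalizing y z r q with
  | zero =>
    obtain rfl := List.length_eq_zero_iff.1 hn
    have : q = [y, z] := by
      induction h with
      | refl => rfl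
      | tail _ h2 ih =>
        subst ih
        cases h2 with
        | cons x h => cases h with
          | cons x h => cases h
    exact ⟨z, [], this, Or.inl ⟨rfl, .refl _⟩⟩
  | succ n ih =>
    induction h with
    | refl => exact ⟨z, r, rfl, Or.inl ⟨rfl, .refl _⟩⟩
    | @tail q q' h1 h2 ihq =>
      obtain ⟨z₁, r₁, rfl, hcase⟩ := ihq
      have hlen : r₁.length = n + 1 := by
        have := SwapEq.length_eq h1
        simp at this
        omega
      cases h2 with
      | cons _ h2 =>
        obtain ⟨r₂, rfl⟩ := h2.exists_cons
        refine ⟨z₁, r₂, rfl, ?_⟩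
        rcases hcase with ⟨rfl, h⟩ | ⟨x, t, hsq, h3, h4⟩
        · exact Or.inl ⟨rfl, h.tail h2⟩
        · exact Or.inr ⟨x, t, hsq, h3, (Relation.ReflTransGen.single h2.symm).trans h4⟩
      | @swap a _ _ d s hsq' =>
        refine ⟨d, a :: s, rfl, ?_⟩
        rcases hcase with ⟨rfl, h⟩ | ⟨x, t, hsq, h3, h4⟩
        · exact Or.inr ⟨a, s, hsq', h, .refl _⟩
        · have hs : s.length = n := by simpa using hlen
          obtain ⟨x', t', heq, hcase'⟩ := ih h4 hs
          obtain ⟨rfl, rfl⟩ : x = x' ∧ t = t' := by simpa using heq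
          rcases hcase' with ⟨rfl, h5⟩ | ⟨w, s', hsq₂, h5, h6⟩
          · obtain rfl : z = d := hsq.reflect.corner_unique hsq'
            exact Or.inl ⟨rfl, h3.trans (h5.symm.cons _)⟩
          · obtain ⟨v, hv₁, hv₂, hv₃⟩ := exists_cube_corner hN (v := z₁) (a := x) (b := a) (e := y)
              (p := w) (r := d) (s := z) hsq₂.rotate.rotate hsq'.reflect.rotate.rotate.rotate
              hsq.rotate.rotate.rotate
            refine Or.inr ⟨v, w :: s', hv₃.rotate.rotate, ?_, ?_⟩
            · exact h3.trans ((h6.cons _).trans (.of_square hv₁.reflect.rotate.rotate.rotate _))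
            · exact (h5.cons _).trans (.of_square hv₂.reflect.rotate.rotate.rotate _)

/-! ### Reduced paths -/

/-- The path contains a backtrack. -/
inductive HasBacktrack : List V → Prop
  | here (a b : V) (t : List V) : HasBacktrack (a :: b :: a :: t)
  | there (x : V) {q : List V} : HasBacktrack q → HasBacktrack (x :: q)

theorem HasBacktrack.three_le {q : List V} (h : HasBacktrack q) : 3 ≤ q.length := by
  induction h with
  | here a b t => simp
  | there x _ ih => simp; omega

variable (T) in
/-- No backtrack can be created by pushing the path across squares. -/
def Reduced (q : List V) : Prop := ∀ q', T.SwapEq q q' → ¬ HasBacktrack q'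

theorem Reduced.of_swapEq {q q' : List V} (h : T.Reduced q) (h' : T.SwapEq q q') : T.Reduced q' :=
  fun _ h2 => h _ (h'.trans h2)

theorem Reduced.tail {x : V} {q : List V} (h : T.Reduced (x :: q)) : T.Reduced q :=
  fun _ h2 h3 => h _ (h2.cons x) (.there x h3)

/-- If a reduced path is no longer reduced after one more edge, then it can be pushed to a path that
ends with the inverse of this edge. -/
theorem Reduced.exists_of_not_reduced_cons (hN : T.NonPositivelyCurved) {y z : V} {r : List V}
    (h : T.Reduced (y :: r)) (h' : ¬ T.Reduced (z :: y :: r)) :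
    ∃ t, T.SwapEq (y :: r) (y :: z :: t) := by
  induction hn : r.length generalizing y z r with
  | zero =>
    obtain rfl := List.length_eq_zero_iff.1 hn
    refine absurd (fun q' h1 h2 => ?_) h'
    have := h1.length_eq
    have := h2.three_le
    simp at *
    omega
  | succ n ih =>
    simp only [Reduced, not_forall, not_not] at h'
    obtain ⟨q', h1, h2⟩ := h'
    obtain ⟨y', r', rfl, ⟨rfl, hA⟩ | ⟨x, t, hsq, h3, h4⟩⟩ := h1.exchange hN
    · cases h2 with
      | here _ _ t => exact ⟨t, hA⟩
      | there _ h2 => exact absurd h2 (h _ hA)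
    · have hred := h.of_swapEq h3
      have hlen : t.length = n := by
        have := h3.length_eq
        simp at this
        omega
      have hnot : ¬ T.Reduced (y' :: x :: t) ∨ y = z := by
        cases h2 with
        | here _ _ t' =>
          obtain ⟨x', t'', heq, ⟨rfl, -⟩ | ⟨w, s, hsq', h5, h6⟩⟩ := h4.exchange hN
          · obtain ⟨rfl, rfl⟩ : x = z ∧ t = t'' := by simpa using heq
            exact absurd rfl hsq.2.1
          · obtain ⟨rfl, rfl⟩ : x = x' ∧ t = t'' := by simpa using heq
            obtain rfl : w = y := hsq'.rotate.corner_unique hsq.rotate.rotate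
            exact absurd (.here _ _ _) (h _ (h3.trans (h6.cons _)))
        | there _ h2 => exact Or.inl fun h5 => h5 _ h4.symm h2
      rcases hnot with hnot | rfl
      · obtain ⟨s, hs⟩ := ih hred.tail hnot hlen
        exact ⟨y' :: s, h3.trans ((hs.cons _).trans (.of_square hsq.rotate.rotate.rotate _))⟩
      · exact absurd rfl hsq.1.2.2.1.1

/-! ### Lifting edge paths to reduced paths -/

variable (T) in
/-- The reduced paths `q` (ending at `y`) and `q'` (ending at `z`) differ by the edge `y z`.  The
reduced paths from a basepoint up to pushes, with this adjacency, form a covering of the complex. -/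
def LiftStep (y z : V) (q q' : List V) : Prop :=
  (T.SwapEq q (y :: q') ∧ ∃ r, q' = z :: r) ∨ (T.SwapEq q' (z :: q) ∧ ∃ r, q = y :: r)

theorem LiftStep.symm {y z : V} {q q' : List V} (h : T.LiftStep y z q q') : T.LiftStep z y q' q :=
  Or.symm h

variable (T) in
/-- A reduced path that ends at `x`. -/
def ReducedTo (x : V) (q : List V) : Prop := T.Reduced q ∧ ∃ r, q = x :: r

theorem ReducedTo.of_swapEq {x : V} {q q' : List V} (h : T.ReducedTo x q) (h' : T.SwapEq q q') :
    T.ReducedTo x q' := by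
  obtain ⟨h1, r, rfl⟩ := h
  exact ⟨h1.of_swapEq h', h'.exists_cons⟩

theorem LiftStep.congr {y z : V} {q q' p p' : List V} (h : T.LiftStep y z q q')
    (hq : T.SwapEq q p) (hq' : T.SwapEq q' p') : T.LiftStep y z p p' := by
  rcases h with ⟨h1, r, rfl⟩ | ⟨h1, r, rfl⟩
  · exact Or.inl ⟨hq.symm.trans (h1.trans (hq'.cons _)), hq'.exists_cons⟩
  · exact Or.inr ⟨hq'.symm.trans (h1.trans (hq.cons _)), hq.exists_cons⟩

theorem SwapEq.cancel (hN : T.NonPositivelyCurved) {y z : V} {r r' : List V}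
    (h : T.SwapEq (y :: z :: r) (y :: z :: r')) : T.SwapEq (z :: r) (z :: r') := by
  obtain ⟨z', r'', heq, ⟨rfl, h1⟩ | ⟨x, t, hsq, -, -⟩⟩ := h.exchange hN
  · obtain rfl : r' = r'' := by simpa using heq
    exact h1
  · obtain ⟨rfl, rfl⟩ : z = z' ∧ r' = r'' := by simpa using heq
    exact absurd rfl hsq.2.2

theorem LiftStep.unique (hN : T.NonPositivelyCurved) {y z : V} {q q₁ q₂ : List V}
    (h₁ : T.LiftStep y z q q₁) (h₂ : T.LiftStep y z q q₂) (hr₁ : T.Reduced q₁)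
    (hr₂ : T.Reduced q₂) : T.SwapEq q₁ q₂ := by
  rcases h₁ with ⟨h1, r, rfl⟩ | ⟨h1, r, rfl⟩ <;> rcases h₂ with ⟨h2, r', h2'⟩ | ⟨h2, r', h2'⟩
  · subst h2'
    exact (h1.symm.trans h2).cancel hN
  · exact absurd (.here _ _ _) (hr₂ _ (h2.trans (h1.cons _)))
  · subst h2'
    exact absurd (.here _ _ _) (hr₁ _ (h1.trans (h2.cons _)))
  · exact h1.trans h2.symm

theorem exists_liftStep (hN : T.NonPositivelyCurved) {y : V} (z : V) {q : List V}
    (h : T.ReducedTo y q) : ∃ q', T.ReducedTo z q' ∧ T.LiftStep y z q q' := by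
  obtain ⟨h1, r, rfl⟩ := h
  by_cases h2 : T.Reduced (z :: y :: r)
  · exact ⟨z :: y :: r, ⟨h2, _, rfl⟩, Or.inr ⟨.refl _, _, rfl⟩⟩
  · obtain ⟨t, ht⟩ := h1.exists_of_not_reduced_cons hN h2
    exact ⟨z :: t, ⟨(h1.of_swapEq ht).tail, _, rfl⟩, Or.inl ⟨ht, _, rfl⟩⟩

/-- Squares lift to closed squares. -/
theorem LiftStep.square (hN : T.NonPositivelyCurved) {a b c d : V} (hsq : T.IsProperSquare a b c d)
    {q q₁ q₂ : List V} (hq : T.ReducedTo a q) (hq₁ : T.ReducedTo b q₁) (hq₂ : T.ReducedTo c q₂)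
    (h₁ : T.LiftStep a b q q₁) (h₂ : T.LiftStep b c q₁ q₂) :
    ∃ q₃, T.ReducedTo d q₃ ∧ T.LiftStep a d q q₃ ∧ T.LiftStep d c q₃ q₂ := by
  obtain ⟨hq, r, rfl⟩ := hq
  obtain ⟨hq₁, r₁, rfl⟩ := hq₁
  obtain ⟨hq₂, r₂, rfl⟩ := hq₂
  rcases h₁ with ⟨h1, -⟩ | ⟨h1, -⟩ <;> rcases h₂ with ⟨h2, -⟩ | ⟨h2, -⟩
  · have h3 : T.SwapEq (a :: r) (a :: d :: c :: r₂) :=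
      h1.trans ((h2.cons _).trans (
        .of_square hsq.reflect.rotate.rotate _))
    exact ⟨d :: c :: r₂, ⟨(hq.of_swapEq h3).tail, _, rfl⟩, Or.inl ⟨h3, _, rfl⟩,
      Or.inl ⟨.refl _, _, rfl⟩⟩
  · by_cases h3 : T.Reduced (d :: a :: r)
    · refine ⟨d :: a :: r, ⟨h3, _, rfl⟩, Or.inr ⟨.refl _, _, rfl⟩, Or.inl ⟨?_, _, rfl⟩⟩
      exact (h1.cons _).trans ((SwapEq.of_square hsq.reflect.rotate.rotate.rotate _).trans
        (h2.symm.cons _))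
    · exfalso
      obtain ⟨t, ht⟩ := hq.exists_of_not_reduced_cons hN h3
      obtain ⟨x, t', heq, ⟨rfl, -⟩ | ⟨w, s, hsq', h5, -⟩⟩ := (h1.symm.trans ht).exchange hN
      · obtain ⟨rfl, -⟩ : d = b ∧ t = t' := by simpa using heq
        exact hsq.2.2 rfl
      · obtain ⟨rfl, rfl⟩ : d = x ∧ t = t' := by simpa using heq
        obtain rfl : w = c := hsq'.rotate.corner_unique
          hsq.reflect.rotate.rotate.rotate
        exact hq₂ _ (h2.trans (h5.cons _)) (.here _ _ _)
  · obtain ⟨x, t', heq, ⟨rfl, -⟩ | ⟨w, s, hsq', h5, h6⟩⟩ := (h1.symm.trans h2).exchange hN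
    · obtain ⟨rfl, -⟩ : c = a ∧ r₂ = t' := by simpa using heq
      exact absurd rfl hsq.2.1
    · obtain ⟨rfl, rfl⟩ : c = x ∧ r₂ = t' := by simpa using heq
      obtain rfl : w = d := hsq'.rotate.corner_unique hsq
      exact ⟨w :: s, ⟨(hq.of_swapEq h5).tail, _, rfl⟩, Or.inl ⟨h5, _, rfl⟩,
        Or.inr ⟨h6, _, rfl⟩⟩
  · have h3 : T.SwapEq (c :: r₂) (c :: d :: a :: r) :=
      h2.trans ((h1.cons _).trans (.of_square hsq _))
    exact ⟨d :: a :: r, ⟨(hq₂.of_swapEq h3).tail, _, rfl⟩, Or.inr ⟨.refl _, _, rfl⟩,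
      Or.inr ⟨h3, _, rfl⟩⟩

/-- `Lifts p q q'`: the lift of the edge path `p` that starts at the reduced path `q` ends at `q'`. -/
def Lifts : ∀ {x y : V}, T.graph.Walk x y → List V → List V → Prop
  | _, _, .nil, q, q' => T.SwapEq q q'
  | x, _, .cons (v := z) _ p, q, q' => ∃ q₁, T.ReducedTo z q₁ ∧ T.LiftStep x z q q₁ ∧ Lifts p q₁ q'

theorem Lifts.congr_left {x y : V} (p : T.graph.Walk x y) {q q₁ q' : List V} (h : T.SwapEq q q₁) :
    Lifts p q q' → Lifts p q₁ q' := by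
  cases p with
  | nil => exact fun h' => h.symm.trans h'
  | cons e p => exact fun ⟨q₂, h2, h3, h4⟩ => ⟨q₂, h2, h3.congr h (.refl _), h4⟩

theorem Lifts.reducedTo {x y : V} (p : T.graph.Walk x y) {q q' : List V} (h : T.ReducedTo x q) :
    Lifts p q q' → T.ReducedTo y q' := by
  induction p generalizing q with
  | nil => exact fun h' => h.of_swapEq h'
  | cons e p ih => exact fun ⟨q₂, h2, _, h4⟩ => ih h2 h4

theorem lifts_append {x y z : V} (p : T.graph.Walk x y) (r : T.graph.Walk y z) {q q' : List V} :
    Lifts (p.append r) q q' ↔ ∃ q₁, Lifts p q q₁ ∧ Lifts r q₁ q' := by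
  induction p generalizing q with
  | nil => exact ⟨fun h => ⟨q, .refl _, h⟩, fun ⟨q₁, h1, h2⟩ => Lifts.congr_left r h1.symm h2⟩
  | cons e p ih =>
    rw [SimpleGraph.Walk.cons_append]
    simp only [Lifts, ih]
    constructor
    · rintro ⟨q₁, h1, h2, q₂, h3, h4⟩; exact ⟨q₂, ⟨q₁, h1, h2, h3⟩, h4⟩
    · rintro ⟨q₂, ⟨q₁, h1, h2, h3⟩, h4⟩; exact ⟨q₁, h1, h2, q₂, h3, h4⟩

theorem Lifts.unique (hN : T.NonPositivelyCurved) {x y : V} (p : T.graph.Walk x y)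
    {q q₁ q₂ : List V} : Lifts p q q₁ → Lifts p q q₂ → T.SwapEq q₁ q₂ := by
  induction p generalizing q with
  | nil => exact fun h1 h2 => h1.symm.trans h2
  | cons e p ih =>
    rintro ⟨s₁, h1, h2, h3⟩ ⟨s₂, h1', h2', h3'⟩
    exact ih h3 (Lifts.congr_left p (h2'.unique hN h2 h1'.1 h1.1) h3')

theorem Homotopic.lifts_iff (hN : T.NonPositivelyCurved) {x y : V} {p p' : T.graph.Walk x y}
    (h : T.Homotopic p p') {q q' : List V} (hq : T.ReducedTo x q) :
    Lifts p q q' ↔ Lifts p' q q' := by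
  induction h generalizing q q' with
  | refl => rfl
  | symm _ ih => exact (ih hq).symm
  | trans _ _ ih1 ih2 => exact (ih1 hq).trans (ih2 hq)
  | backtrack p hab hba r =>
    rw [lifts_append, lifts_append]
    refine exists_congr fun q₁ => and_congr_right fun h1 => ?_
    have hq₁ := Lifts.reducedTo p hq h1
    constructor
    · rintro ⟨q₂, h2, h3, q₃, h4, h5, h6⟩
      exact Lifts.congr_left r (h5.unique hN h3.symm h4.1 hq₁.1) h6
    · intro h2
      obtain ⟨q₂, h3, h4⟩ := exists_liftStep hN _ hq₁
      exact ⟨q₂, h3, h4, q₁, hq₁, h4.symm, h2⟩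
  | square p hab hbc had hdc r hsq =>
    rcases hsq.proper_or with hsq | ⟨-, rfl⟩
    · rw [lifts_append, lifts_append]
      refine exists_congr fun q₁ => and_congr_right fun h1 => ?_
      have hq₁ := Lifts.reducedTo p hq h1
      constructor
      · rintro ⟨q₂, h2, h3, q₃, h4, h5, h6⟩
        obtain ⟨q₄, h7, h8, h9⟩ := LiftStep.square hN hsq hq₁ h2 h4 h3 h5
        exact ⟨q₄, h7, h8, q₃, h4, h9, h6⟩
      · rintro ⟨q₂, h2, h3, q₃, h4, h5, h6⟩
        obtain ⟨q₄, h7, h8, h9⟩ := LiftStep.square hN hsq.reflect hq₁ h2 h4 h3 h5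
        exact ⟨q₄, h7, h8, q₃, h4, h9, h6⟩
    · rfl

/-! ### The quadrangle condition -/

variable (T) in
/-- The edge paths from `x`, as reversed lists of vertices. -/
inductive PathFrom (x : V) : V → List V → Prop
  | nil : PathFrom x x [x]
  | cons {y z : V} {q : List V} : PathFrom x y q → T.graph.Adj y z → PathFrom x z (z :: q)

theorem PathFrom.exists_cons {x y : V} {q : List V} (h : T.PathFrom x y q) : ∃ r, q = y :: r := by
  cases h <;> exact ⟨_, rfl⟩

theorem PathFrom.exists_walk {x y : V} {q : List V} (h : T.PathFrom x y q) :
    ∃ p : T.graph.Walk x y, p.length + 1 = q.length := by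
  induction h with
  | nil => exact ⟨.nil, rfl⟩
  | cons _ hadj ih =>
    obtain ⟨p, hp⟩ := ih
    exact ⟨p.concat hadj, by simp [hp]⟩

theorem PathFrom.dist_lt {x y : V} {q : List V} (h : T.PathFrom x y q) :
    T.graph.dist x y < q.length := by
  obtain ⟨p, hp⟩ := h.exists_walk
  have := SimpleGraph.dist_le p
  omega

theorem exists_pathFrom (hc : T.graph.Connected) (x y : V) :
    ∃ q, T.PathFrom x y q ∧ q.length = T.graph.dist x y + 1 := by
  obtain ⟨p, hp⟩ := hc.exists_walk_length_eq_dist x y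
  have : ∀ {x y : V} (p : T.graph.Walk x y) (z : V) (q : List V), T.PathFrom z x q →
      ∃ q', T.PathFrom z y q' ∧ q'.length = p.length + q.length := by
    intro x y p
    induction p with
    | nil => exact fun z q hq => ⟨q, hq, by simp⟩
    | cons e p ih =>
      intro z q hq
      obtain ⟨q', h1, h2⟩ := ih z _ (hq.cons e)
      exact ⟨q', h1, by simp [h2]; omega⟩
  obtain ⟨q, h1, h2⟩ := this p x [x] .nil
  exact ⟨q, h1, by simp [h2, hp]⟩

theorem PathFrom.of_swapStep {x y : V} {q q' : List V} (h : T.PathFrom x y q)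
    (h' : T.SwapStep q q') : T.PathFrom x y q' := by
  induction h' generalizing y with
  | @swap a b c d t hsq =>
    cases h with
    | cons h1 e1 => cases h1 with
      | cons h2 e2 =>
        obtain ⟨r, hr⟩ := h2.exists_cons
        obtain ⟨rfl, rfl⟩ := List.cons.inj hr
        exact (h2.cons hsq.1.2.2.2.2.symm).cons hsq.1.2.2.2.1.symm
  | cons z h1 ih =>
    cases h with
    | nil => cases h1
    | cons h2 e => exact (ih h2).cons e

theorem PathFrom.of_swapEq {x y : V} {q q' : List V} (h : T.PathFrom x y q)
    (h' : T.SwapEq q q') : T.PathFrom x y q' := by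
  induction h' with
  | refl => exact h
  | tail _ h2 ih => exact ih.of_swapStep h2

theorem PathFrom.exists_shorter {x y : V} {q : List V} (h : T.PathFrom x y q)
    (hb : HasBacktrack q) : ∃ q', T.PathFrom x y q' ∧ q'.length + 2 = q.length := by
  induction hb generalizing y with
  | here a b t =>
    cases h with
    | cons h1 e1 => cases h1 with
      | cons h2 e2 =>
        obtain ⟨r, hr⟩ := h2.exists_cons
        obtain ⟨rfl, rfl⟩ := List.cons.inj hr
        exact ⟨_, h2, by simp⟩
  | there z hb ih =>
    cases h with
    | nil => cases hb
    | cons h2 e =>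
      obtain ⟨q', h3, h4⟩ := ih h2
      exact ⟨_, h3.cons e, by simp; omega⟩

theorem PathFrom.reduced {x y : V} {q : List V} (h : T.PathFrom x y q)
    (hl : q.length = T.graph.dist x y + 1) : T.Reduced q := by
  intro q' h1 h2
  obtain ⟨q'', h3, h4⟩ := (h.of_swapEq h1).exists_shorter h2
  have := h3.dist_lt
  have := h1.length_eq
  omega

theorem PathFrom.exists_lifts {x y : V} {q : List V} (h : T.PathFrom x y q) (hr : T.Reduced q) :
    ∃ p : T.graph.Walk x y, Lifts p [x] q := by
  induction h with
  | nil => exact ⟨.nil, .refl _⟩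
  | @cons y z q h e ih =>
    obtain ⟨p, hp⟩ := ih hr.tail
    refine ⟨p.append (.cons e .nil), (lifts_append _ _).2 ⟨q, hp, z :: q, ⟨hr, _, rfl⟩, ?_, .refl _⟩⟩
    exact Or.inr ⟨.refl _, h.exists_cons⟩

/-- Two geodesics with the same endpoints differ by pushes across squares. -/
theorem PathFrom.swapEq_of_geodesic (hT : T.IsCAT0) {x y : V} {q q' : List V}
    (h : T.PathFrom x y q) (h' : T.PathFrom x y q') (hl : q.length = T.graph.dist x y + 1)
    (hl' : q'.length = T.graph.dist x y + 1) : T.SwapEq q q' := by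
  obtain ⟨p, hp⟩ := h.exists_lifts (h.reduced hl)
  obtain ⟨p', hp'⟩ := h'.exists_lifts (h'.reduced hl')
  have hx : T.ReducedTo x [x] := by
    refine ⟨fun q' h1 h2 => ?_, [], rfl⟩
    have := h1.length_eq
    have := h2.three_le
    simp at *
    omega
  exact Lifts.unique hT.2 p' (((hT.1.2 x y p p').lifts_iff hT.2 hx).1 hp) hp'

/-- Quadrangle condition: two neighbours of `y` that are closer to `x` than `y` span a square with `y`,
whose fourth corner is closer still. -/
theorem IsCAT0.quadrangle (hT : T.IsCAT0) {x y z z' : V} (hz : T.graph.Adj z y)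
    (hz' : T.graph.Adj z' y) (hd : T.graph.dist x z + 1 = T.graph.dist x y)
    (hd' : T.graph.dist x z' + 1 = T.graph.dist x y) (hne : z ≠ z') :
    ∃ t, T.IsProperSquare t z y z' ∧ T.graph.dist x t + 2 = T.graph.dist x y := by
  obtain ⟨q, hq, hl⟩ := exists_pathFrom hT.1.1 x z
  obtain ⟨q', hq', hl'⟩ := exists_pathFrom hT.1.1 x z'
  have h := (hq.cons hz).swapEq_of_geodesic hT (hq'.cons hz') (by simp; omega) (by simp; omega)
  obtain ⟨r, rfl⟩ := hq.exists_cons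
  obtain ⟨r', rfl⟩ := hq'.exists_cons
  obtain ⟨z₁, r₁, heq, ⟨rfl, -⟩ | ⟨t, s, hsq, h1, -⟩⟩ := h.exchange hT.2
  · exact absurd (by simpa using heq.symm : z = z' ∧ _).1 hne
  · obtain ⟨rfl, rfl⟩ : z' = z₁ ∧ r' = r₁ := by simpa using heq
    refine ⟨t, hsq, ?_⟩
    have h2 := hq.of_swapEq h1
    cases h2 with
    | cons h3 e =>
      obtain ⟨r₂, hr₂⟩ := h3.exists_cons
      obtain ⟨rfl, -⟩ := List.cons.inj hr₂
      have h4 := h3.dist_lt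
      have h5 := h1.length_eq
      have h6 := e.diff_dist_adj (u := x)
      simp at *
      omega

theorem Homotopic.length_mod_two {x y : V} {p q : T.graph.Walk x y} (h : T.Homotopic p q) :
    p.length % 2 = q.length % 2 := by
  induction h with
  | refl => rfl
  | symm _ ih => exact ih.symm
  | trans _ _ ih1 ih2 => exact ih1.trans ih2
  | backtrack p hab hba q => simp; omega
  | square p hab hbc had hdc q hsq => simp

/-- The 1-skeleton is bipartite. -/
theorem IsCAT0.dist_ne (hT : T.IsCAT0) (x : V) {a b : V} (h : T.graph.Adj a b) :
    T.graph.dist x a ≠ T.graph.dist x b := by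
  intro he
  obtain ⟨p, hp⟩ := hT.1.1.exists_walk_length_eq_dist x a
  obtain ⟨q, hq⟩ := hT.1.1.exists_walk_length_eq_dist x b
  have := (hT.1.2 x b (p.concat h) q).length_mod_two
  simp [hp, hq, he] at this
  omega

end CubeComplex

namespace CubeComplex

variable {V : Type u} {T : CubeComplex V}

/-! ### Halfspaces, intervals and hulls -/

variable (T) in
/-- The halfspace of the vertices closer to `a` than to `b`, for an edge `a b`. -/
def halfspace (a b : V) : Set V := {x | T.graph.dist x a < T.graph.dist x b}

variable (T) in
/-- The set of vertices is one of the two halfspaces of an edge. -/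
def IsHalfspace (S : Set V) : Prop := ∃ a b, T.graph.Adj a b ∧ S = T.halfspace a b

theorem IsCAT0.dist_adj (hT : T.IsCAT0) (x : V) {a b : V} (h : T.graph.Adj a b) :
    T.graph.dist x a + 1 = T.graph.dist x b ∨ T.graph.dist x b + 1 = T.graph.dist x a := by
  have h1 := hT.dist_ne x h
  have h2 := h.diff_dist_adj (u := x)
  omega

theorem IsCAT0.mem_halfspace (hT : T.IsCAT0) {x a b : V} (h : T.graph.Adj a b) :
    x ∈ T.halfspace a b ↔ T.graph.dist x a + 1 = T.graph.dist x b := by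
  have := hT.dist_adj x h
  simp only [halfspace, Set.mem_ofPred_eq]
  omega

theorem IsCAT0.compl_halfspace (hT : T.IsCAT0) {a b : V} (h : T.graph.Adj a b) :
    (T.halfspace a b)ᶜ = T.halfspace b a := by
  ext x
  have := hT.dist_adj x h
  simp only [halfspace, Set.mem_compl_iff, Set.mem_ofPred_eq]
  omega

theorem IsCAT0.halfspace_subset_of_square (hT : T.IsCAT0) {a b c d : V}
    (h : T.IsProperSquare a b c d) : T.halfspace a b ⊆ T.halfspace d c := by
  intro x hx
  rw [hT.mem_halfspace h.1.2.1] at hx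
  rw [hT.mem_halfspace h.1.2.2.2.1.symm]
  have h1 := hT.dist_adj x h.1.2.2.1
  have h2 := hT.dist_adj x h.1.2.2.2.1
  have h3 := hT.dist_adj x h.1.2.2.2.2
  by_contra hne
  obtain ⟨t, ht, hd⟩ := hT.quadrangle (x := x) h.1.2.1 h.1.2.2.1.symm hx (by omega) h.2.1
  obtain rfl := ht.rotate.corner_unique h
  omega

/-- Opposite edges of a square have the same halfspaces. -/
theorem IsCAT0.halfspace_eq_of_square (hT : T.IsCAT0) {a b c d : V}
    (h : T.IsProperSquare a b c d) : T.halfspace a b = T.halfspace d c :=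
  (hT.halfspace_subset_of_square h).antisymm
    (hT.halfspace_subset_of_square h.reflect.rotate)

theorem exists_adj_closer (hc : T.graph.Connected) {x y : V} (h : 0 < T.graph.dist x y) :
    ∃ z, T.graph.Adj z y ∧ T.graph.dist x z + 1 = T.graph.dist x y := by
  obtain ⟨q, hq, hl⟩ := exists_pathFrom hc x y
  cases hq with
  | nil => simp at h
  | @cons z _ q hq e =>
    refine ⟨z, e, ?_⟩
    have h1 := hq.dist_lt
    have h2 := e.diff_dist_adj (u := x)
    simp at hl
    omega

/-- An edge that crosses a halfspace defines the same halfspace. -/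
theorem IsCAT0.halfspace_eq_of_crossing (hT : T.IsCAT0) {a b p q : V} (hab : T.graph.Adj a b)
    (hpq : T.graph.Adj p q) (hp : p ∈ T.halfspace a b) (hq : q ∉ T.halfspace a b) :
    T.halfspace p q = T.halfspace a b := by
  induction hk : T.graph.dist a p generalizing p q with
  | zero =>
    obtain rfl := hT.1.1.dist_eq_zero_iff.1 hk
    rw [hT.mem_halfspace hab] at hq
    have h1 := hT.dist_adj q hab
    have h2 : T.graph.dist q a = 1 := SimpleGraph.dist_eq_one_iff_adj.2 hpq.symm
    obtain rfl := hT.1.1.dist_eq_zero_iff.1 (show T.graph.dist q b = 0 by omega)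
    rfl
  | succ k ih =>
    rw [hT.mem_halfspace hab] at hp hq
    obtain ⟨p', hp', hd⟩ := exists_adj_closer hT.1.1 (x := a) (y := p) (by omega)
    have h1 := hT.dist_adj q hab
    have h2 := hT.dist_adj a hpq
    have h3 := hT.dist_adj b hpq
    have h4 := hT.dist_adj p' hab
    have h5 := hT.dist_adj b hp'
    simp only [SimpleGraph.dist_comm (u := p), SimpleGraph.dist_comm (u := q),
      SimpleGraph.dist_comm (u := p')] at *
    have hne : p' ≠ q := by rintro rfl; omega
    obtain ⟨t, ht, hdt⟩ := hT.quadrangle (x := b) hp' hpq.symm (by omega) (by omega) hne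
    rw [← hT.halfspace_eq_of_square ht.reflect.rotate.rotate.rotate]
    have h6 := hT.dist_adj a ht.1.2.2.2.2
    refine ih ht.1.2.1.symm ?_ ?_ (by omega)
    · rw [hT.mem_halfspace hab]
      simp only [SimpleGraph.dist_comm (u := p')]
      omega
    · rw [hT.mem_halfspace hab]
      simp only [SimpleGraph.dist_comm (u := t)]
      omega

/-- A geodesic from `x ∈ S` to `z ∉ S` has an edge that leaves `S`. -/
theorem exists_crossing (hc : T.graph.Connected) {S : Set V} {x z : V} (hx : x ∈ S) (hz : z ∉ S) :
    ∃ p q, T.graph.Adj p q ∧ p ∈ S ∧ q ∉ S ∧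
      T.graph.dist x p + 1 + T.graph.dist q z = T.graph.dist x z := by
  induction hk : T.graph.dist x z generalizing z with
  | zero =>
    obtain rfl := hc.dist_eq_zero_iff.1 hk
    exact absurd hx hz
  | succ k ih =>
    obtain ⟨z', hz', hd⟩ := exists_adj_closer hc (x := x) (y := z) (by omega)
    by_cases hS : z' ∈ S
    · exact ⟨z', z, hz', hS, hz, by simp; omega⟩
    · obtain ⟨p, q, h1, h2, h3, h4⟩ := ih hS (by omega)
      refine ⟨p, q, h1, h2, h3, ?_⟩
      have h5 := hc.dist_triangle (u := q) (v := z') (w := z)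
      have h6 := hc.dist_triangle (u := x) (v := p) (w := z)
      have h7 := hc.dist_triangle (u := p) (v := q) (w := z)
      have h8 : T.graph.dist z' z = 1 := SimpleGraph.dist_eq_one_iff_adj.2 hz'
      have h9 : T.graph.dist p q = 1 := SimpleGraph.dist_eq_one_iff_adj.2 h1
      omega

theorem IsCAT0.isConvex_halfspace (hT : T.IsCAT0) {a b : V} (hab : T.graph.Adj a b) :
    T.IsConvex (T.halfspace a b) := by
  intro x hx y hy z hz
  by_contra hzn
  obtain ⟨p, q, hpq, hp, hq, hd⟩ := exists_crossing hT.1.1 hx hzn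
  rw [← hT.halfspace_eq_of_crossing hab hpq hp hq, hT.mem_halfspace hpq,
    SimpleGraph.dist_comm (u := y), SimpleGraph.dist_comm (u := y)] at hy
  have h1 := hT.1.1.dist_triangle (u := x) (v := p) (w := y)
  have h2 := hT.1.1.dist_triangle (u := q) (v := z) (w := y)
  omega

theorem IsCAT0.isConvex_of_isHalfspace (hT : T.IsCAT0) {S : Set V} (h : T.IsHalfspace S) :
    T.IsConvex S := by
  obtain ⟨a, b, hab, rfl⟩ := h
  exact hT.isConvex_halfspace hab

theorem IsCAT0.isHalfspace_compl (hT : T.IsCAT0) {S : Set V} (h : T.IsHalfspace S) :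
    T.IsHalfspace Sᶜ := by
  obtain ⟨a, b, hab, rfl⟩ := h
  exact ⟨b, a, hab.symm, hT.compl_halfspace hab⟩

/-- A vertex on no geodesic from `a` to `b` is separated from both by a halfspace: the one where the
distance to `a` first drops along a geodesic from the vertex to `b`. -/
theorem IsCAT0.exists_halfspace (hT : T.IsCAT0) {a b v : V}
    (h : T.graph.dist a v + T.graph.dist v b ≠ T.graph.dist a b) :
    ∃ S, T.IsHalfspace S ∧ a ∈ S ∧ b ∈ S ∧ v ∉ S := by
  obtain ⟨p, q, hpq, hp, hq, hd⟩ := exists_crossing hT.1.1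
    (S := {y | T.graph.dist a v + T.graph.dist v y = T.graph.dist a y}) (x := v) (z := b)
    (by simp) h
  simp only [Set.mem_ofPred_eq] at hp hq
  have h1 := hT.dist_adj a hpq
  have h2 := hT.dist_adj v hpq
  have h3 := hT.dist_adj b hpq
  have h4 := hT.1.1.dist_triangle (u := v) (v := q) (w := b)
  have h5 := hT.1.1.dist_triangle (u := v) (v := p) (w := b)
  have h6 := SimpleGraph.dist_comm (G := T.graph) (u := b) (v := p)
  have h7 := SimpleGraph.dist_comm (G := T.graph) (u := b) (v := q)
  refine ⟨_, ⟨q, p, hpq.symm, rfl⟩, ?_, ?_, ?_⟩ <;> rw [hT.mem_halfspace hpq.symm] <;> omega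

/-- Intervals are convex. -/
theorem IsCAT0.interval_convex (hT : T.IsCAT0) {a b x y z : V}
    (hx : T.graph.dist a x + T.graph.dist x b = T.graph.dist a b)
    (hy : T.graph.dist a y + T.graph.dist y b = T.graph.dist a b)
    (hz : T.graph.dist x z + T.graph.dist z y = T.graph.dist x y) :
    T.graph.dist a z + T.graph.dist z b = T.graph.dist a b := by
  by_contra hne
  obtain ⟨S, hS, ha, hb, hzS⟩ := hT.exists_halfspace hne
  have hc := hT.isConvex_of_isHalfspace hS
  exact hzS (hc x (hc a ha b hb x hx) y (hc a ha b hb y hy) z hz)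

/-- Only finitely many halfspaces separate two vertices. -/
theorem IsCAT0.finite_halfspaces (hT : T.IsCAT0) (x y : V) :
    {S | T.IsHalfspace S ∧ x ∈ S ∧ y ∉ S}.Finite := by
  obtain ⟨p, -⟩ := hT.1.1.exists_walk_length_eq_dist x y
  refine (p.darts.finite_toSet.image fun d => T.halfspace d.fst d.snd).subset ?_
  rintro S ⟨⟨a, b, hab, rfl⟩, hx, hy⟩
  obtain ⟨d, hd, h1, h2⟩ := p.exists_boundary_dart _ hx hy
  exact ⟨d, hd, hT.halfspace_eq_of_crossing hab d.adj h1 h2⟩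

theorem subset_hull (S : Set V) : S ⊆ T.hull S := Set.subset_sInter fun _ h => h.2

theorem hull_subset {S K : Set V} (hK : T.IsConvex K) (h : S ⊆ K) : T.hull S ⊆ K :=
  Set.sInter_subset_of_mem ⟨hK, h⟩

theorem isConvex_hull (S : Set V) : T.IsConvex (T.hull S) :=
  fun x hx y hy z hz K hK => hK.1 x (hx K hK) y (hy K hK) z hz

variable (T) in
/-- A bi-infinite combinatorial geodesic. -/
def IsLine (w : ℤ → V) : Prop := ∀ m n : ℤ, (T.graph.dist (w m) (w n) : ℤ) = |m - n|

theorem IsLine.between {w : ℤ → V} (hw : T.IsLine w) {a m b : ℤ}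
    (h : |a - m| + |m - b| = |a - b|) :
    T.graph.dist (w a) (w m) + T.graph.dist (w m) (w b) = T.graph.dist (w a) (w b) := by
  have h1 := hw a m
  have h2 := hw m b
  have h3 := hw a b
  omega

theorem IsLine.interval_mono (hc : T.graph.Connected) {w : ℤ → V} (hw : T.IsLine w) {v : V}
    {n m : ℕ} (hnm : n ≤ m)
    (h : T.graph.dist (w (-n)) v + T.graph.dist v (w n) = T.graph.dist (w (-n)) (w n)) :
    T.graph.dist (w (-m)) v + T.graph.dist v (w m) = T.graph.dist (w (-m)) (w m) := by
  have h1 := hw (-n) n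
  have h2 := hw (-m) m
  have h3 := hw (-m) (-n)
  have h4 := hw n m
  have h5 := hc.dist_triangle (u := w (-m)) (v := w (-n)) (w := v)
  have h6 := hc.dist_triangle (u := v) (v := w n) (w := w m)
  have h7 := hc.dist_triangle (u := w (-m)) (v := v) (w := w m)
  rw [show |-(n : ℤ) - n| = 2 * n by grind] at h1
  rw [show |-(m : ℤ) - m| = 2 * m by grind] at h2
  rw [show |-(m : ℤ) - -n| = m - n by grind] at h3
  rw [show |(n : ℤ) - m| = m - n by grind] at h4
  omega

/-- The convex hull of a bi-infinite geodesic is the union of the intervals between its points. -/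
theorem IsCAT0.mem_hull_line_iff (hT : T.IsCAT0) {w : ℤ → V} (hw : T.IsLine w) {v : V} :
    v ∈ T.hull (Set.range w) ↔ ∃ n : ℕ,
      T.graph.dist (w (-n)) v + T.graph.dist v (w n) = T.graph.dist (w (-n)) (w n) := by
  constructor
  · intro hv
    refine hull_subset (K := {v | ∃ n : ℕ,
      T.graph.dist (w (-n)) v + T.graph.dist v (w n) = T.graph.dist (w (-n)) (w n)}) ?_ ?_ hv
    · rintro x ⟨n, hn⟩ y ⟨m, hm⟩ z hz
      exact ⟨max n m, hT.interval_convex (hw.interval_mono hT.1.1 (le_max_left n m) hn)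
        (hw.interval_mono hT.1.1 (le_max_right n m) hm) hz⟩
    · rintro _ ⟨m, rfl⟩
      exact ⟨m.natAbs, hw.between (by grind)⟩
  · rintro ⟨n, hn⟩
    exact isConvex_hull _ _ (subset_hull _ (Set.mem_range_self _)) _
      (subset_hull _ (Set.mem_range_self _)) _ hn

/-! ### The action on the cube complex -/

theorem zpow_smul_of_translates {G : Type v} {X : Type w} {A : Type*} [Group G] [MulAction G X]
    [AddCommGroup A] {g : G} {c : A → X} {τ : A} (h : ∀ t, g • c t = c (t + τ)) (k : ℤ) (t : A) :
    g ^ k • c t = c (t + k • τ) := by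
  induction k generalizing t with
  | zero => simp
  | succ n ih => rw [zpow_add_one, mul_smul, h, ih]; congr 1; module
  | pred n ih =>
    have : g⁻¹ • c t = c (t - τ) := by rw [inv_smul_eq_iff, h, sub_add_cancel]
    rw [zpow_sub_one, mul_smul, this, ih]; congr 1; module

variable {G : Type v} [Group G] [MulAction G V]

theorem IsDeckAction.adj_smul (hG : T.IsDeckAction G) (g : G) {x y : V} (h : T.graph.Adj x y) :
    T.graph.Adj (g • x) (g • y) := by
  refine ⟨fun he => h.1 (smul_left_cancel g he), ?_⟩
  have := hG.smul_mem g _ h.2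
  rwa [← Set.image_smul, Set.image_pair] at this

theorem IsDeckAction.dist_smul (hG : T.IsDeckAction G) (hc : T.graph.Connected) (g : G) (x y : V) :
    T.graph.dist (g • x) (g • y) = T.graph.dist x y := by
  have key : ∀ (g : G) (x y : V), T.graph.dist (g • x) (g • y) ≤ T.graph.dist x y := by
    intro g x y
    obtain ⟨p, hp⟩ := hc.exists_walk_length_eq_dist x y
    rw [← hp, ← p.length_map (⟨fun x => g • x, hG.adj_smul g⟩ : T.graph →g T.graph)]
    exact SimpleGraph.dist_le _
  refine (key g x y).antisymm ?_
  have := key g⁻¹ (g • x) (g • y)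
  simpa using this

theorem IsDeckAction.isHalfspace_smul (hG : T.IsDeckAction G) (hc : T.graph.Connected) (g : G)
    {S : Set V} (hS : T.IsHalfspace S) : T.IsHalfspace (g • S) := by
  obtain ⟨a, b, hab, rfl⟩ := hS
  refine ⟨g • a, g • b, hG.adj_smul g hab, ?_⟩
  ext x
  rw [Set.mem_smul_set_iff_inv_smul_mem]
  simp only [halfspace, Set.mem_ofPred_eq]
  rw [← hG.dist_smul hc g, ← hG.dist_smul hc g _ b, smul_inv_smul]

theorem IsDeckAction.isConvex_smul (hG : T.IsDeckAction G) (hc : T.graph.Connected) (g : G)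
    {S : Set V} (hS : T.IsConvex S) : T.IsConvex (g • S) := by
  intro x hx y hy z hz
  rw [Set.mem_smul_set_iff_inv_smul_mem] at *
  refine hS _ hx _ hy _ ?_
  rwa [hG.dist_smul hc, hG.dist_smul hc, hG.dist_smul hc]

theorem IsDeckAction.smul_hull (hG : T.IsDeckAction G) (hc : T.graph.Connected) (g : G)
    (S : Set V) : g • T.hull S = T.hull (g • S) := by
  apply Set.Subset.antisymm
  · rw [Set.smul_set_subset_iff_subset_inv_smul_set]
    refine hull_subset (hG.isConvex_smul hc _ (isConvex_hull _)) ?_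
    rw [← Set.smul_set_subset_iff_subset_inv_smul_set]
    exact subset_hull _
  · exact hull_subset (hG.isConvex_smul hc _ (isConvex_hull _))
      (Set.smul_set_mono (subset_hull _))

theorem IsLine.smul (hG : T.IsDeckAction G) (hc : T.graph.Connected) (g : G) {w : ℤ → V}
    (hw : T.IsLine w) : T.IsLine (fun n => g • w n) := by
  intro m n
  rw [hG.dist_smul hc]
  exact hw m n

/-- Let `c` translate along two bi-infinite geodesics whose hulls meet.  If some point of the first
geodesic lies outside the hull of the second, then a halfspace `S` separates them; as the hulls meet,
the first geodesic crosses `S`, so that the translates `cᵏ S` are distinct and infinitely many of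
them separate a point of the first geodesic from a point of the second one. -/
theorem IsCAT0.range_subset_hull (hT : T.IsCAT0) (hG : T.IsDeckAction G) {w₁ w₂ : ℤ → V}
    (h₁ : T.IsLine w₁) (h₂ : T.IsLine w₂) {c : G} {τ₁ τ₂ : ℤ} (hτ₁ : τ₁ ≠ 0)
    (hc₁ : ∀ n, c • w₁ n = w₁ (n + τ₁)) (hc₂ : ∀ n, c • w₂ n = w₂ (n + τ₂))
    (hmeet : (T.hull (Set.range w₁) ∩ T.hull (Set.range w₂)).Nonempty) :
    Set.range w₁ ⊆ T.hull (Set.range w₂) := by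
  rintro _ ⟨n₀, rfl⟩
  by_contra hn₀
  have hfin := hT.finite_halfspaces (w₂ 0) (w₁ n₀)
  obtain ⟨S, hS, hwS, hnS⟩ : ∃ S, T.IsHalfspace S ∧ Set.range w₂ ⊆ S ∧ w₁ n₀ ∉ S := by
    by_contra! hcon
    have : ∀ S, ∃ m : ℤ, (T.IsHalfspace S ∧ w₂ 0 ∈ S ∧ w₁ n₀ ∉ S) → w₂ m ∉ S := by
      intro S
      by_cases hS : T.IsHalfspace S ∧ w₂ 0 ∈ S ∧ w₁ n₀ ∉ S
      · have h : ¬ Set.range w₂ ⊆ S := fun h => hS.2.2 (hcon S hS.1 h)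
        obtain ⟨_, ⟨m, rfl⟩, hm⟩ := Set.not_subset.1 h
        exact ⟨m, fun _ => hm⟩
      · exact ⟨0, fun h => absurd h hS⟩
    choose m hm using this
    obtain ⟨N, hN⟩ := (hfin.image fun S => (m S).natAbs).bddAbove
    rw [hT.mem_hull_line_iff h₂] at hn₀
    push Not at hn₀
    obtain ⟨S, hS, ha, hb, hv⟩ := hT.exists_halfspace (hn₀ N)
    have hconv := hT.isConvex_of_isHalfspace hS
    have h0 : w₂ 0 ∈ S := hconv _ ha _ hb _ (h₂.between (by grind))
    have hle : (m S).natAbs ≤ N := hN ⟨S, ⟨hS, h0, hv⟩, rfl⟩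
    exact hm S ⟨hS, h0, hv⟩ (hconv _ ha _ hb _ (h₂.between (by grind)))
  have hconv := hT.isConvex_of_isHalfspace hS
  have hconv' := hT.isConvex_of_isHalfspace (hT.isHalfspace_compl hS)
  obtain ⟨n₁, hn₁⟩ : ∃ n₁, w₁ n₁ ∈ S := by
    by_contra! hcon
    obtain ⟨x, hx₁, hx₂⟩ := hmeet
    exact hull_subset hconv' (by rintro _ ⟨n, rfl⟩; exact hcon n) hx₁ (hull_subset hconv hwS hx₂)
  have hmem₁ : ∀ (k n : ℤ), w₁ n ∈ c ^ k • S ↔ w₁ (n - k * τ₁) ∈ S := by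
    intro k n
    rw [Set.mem_smul_set_iff_inv_smul_mem, ← zpow_neg, zpow_smul_of_translates hc₁, neg_smul,
      smul_eq_mul, sub_eq_add_neg]
  have hmem₂ : ∀ k : ℤ, w₂ 0 ∈ c ^ k • S := by
    intro k
    rw [Set.mem_smul_set_iff_inv_smul_mem, ← zpow_neg, zpow_smul_of_translates hc₂]
    exact hwS ⟨_, rfl⟩
  have hinj : Function.Injective fun k : ℤ => c ^ k • S := by
    intro k l hkl
    by_contra hne
    replace hkl : c ^ k • S = c ^ l • S := hkl
    have hper : c ^ (k - l) • S = S := by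
      rw [sub_eq_neg_add, zpow_add, mul_smul, hkl, ← mul_smul, ← zpow_add, neg_add_cancel,
        zpow_zero, one_smul]
    have hper' : ∀ j : ℤ, c ^ (j * (k - l)) • S = S := by
      intro j
      have hst : c ^ (k - l) ∈ MulAction.stabilizer G S := hper
      have := (MulAction.stabilizer G S).zpow_mem hst j
      rwa [← zpow_mul, mul_comm] at this
    have hout : ∀ j : ℤ, w₁ (n₀ - j * (k - l) * τ₁) ∈ Sᶜ := by
      intro j
      rw [Set.mem_compl_iff, ← hmem₁, hper']
      exact hnS
    have he : (k - l) * τ₁ ≠ 0 := mul_ne_zero (sub_ne_zero.2 hne) hτ₁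
    refine hconv' _ (hout (n₁ - n₀)) _ (hout (-(n₁ - n₀))) _ (h₁.between (m := n₁) ?_) hn₁
    rw [mul_assoc, mul_assoc]
    generalize (k - l) * τ₁ = e at he ⊢
    obtain ⟨d, rfl⟩ : ∃ d, n₁ = n₀ + d := ⟨n₁ - n₀, by ring⟩
    rw [add_sub_cancel_left]
    have habs : |d| ≤ |d * e| := by
      rw [abs_mul]
      exact le_mul_of_one_le_right (abs_nonneg _) (Int.one_le_abs he)
    rw [neg_mul]
    generalize d * e = f at habs ⊢
    grind
  have hside : (∀ k : ℕ, w₁ (n₀ - k * τ₁) ∉ S) ∨ (∀ k : ℕ, w₁ (n₀ - (-k : ℤ) * τ₁) ∉ S) := by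
    by_contra! hcon
    obtain ⟨⟨k, hk⟩, ⟨l, hl⟩⟩ := hcon
    refine hnS (hconv _ hk _ hl _ (h₁.between ?_))
    have h1 : n₀ - k * τ₁ - n₀ = -(k * τ₁) := by ring
    have h2 : n₀ - (n₀ - (-l : ℤ) * τ₁) = -(l * τ₁) := by ring
    have h3 : n₀ - k * τ₁ - (n₀ - (-l : ℤ) * τ₁) = -((k + l) * τ₁) := by ring
    rw [h1, h2, h3, abs_neg, abs_neg, abs_neg, abs_mul, abs_mul, abs_mul, ← add_mul]
    congr 1
    grind
  rcases hside with hside | hside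
  · refine Set.infinite_of_injective_forall_mem (f := fun k : ℕ => c ^ (k : ℤ) • S)
      (fun k l h => by simpa using hinj h) (fun k => ?_) hfin
    exact ⟨hG.isHalfspace_smul hT.1.1 _ hS, hmem₂ _, by rw [hmem₁]; exact hside k⟩
  · refine Set.infinite_of_injective_forall_mem (f := fun k : ℕ => c ^ (-k : ℤ) • S)
      (fun k l h => by simpa using hinj h) (fun k => ?_) hfin
    exact ⟨hG.isHalfspace_smul hT.1.1 _ hS, hmem₂ _, by rw [hmem₁]; exact hside k⟩

/-- Bi-infinite geodesics along which a common element translates have the same hull, or disjoint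
hulls. -/
theorem IsCAT0.hull_eq_of_translates (hT : T.IsCAT0) (hG : T.IsDeckAction G) {w₁ w₂ : ℤ → V}
    (h₁ : T.IsLine w₁) (h₂ : T.IsLine w₂) {c : G} {τ₁ τ₂ : ℤ} (hτ₁ : τ₁ ≠ 0) (hτ₂ : τ₂ ≠ 0)
    (hc₁ : ∀ n, c • w₁ n = w₁ (n + τ₁)) (hc₂ : ∀ n, c • w₂ n = w₂ (n + τ₂))
    (hmeet : (T.hull (Set.range w₁) ∩ T.hull (Set.range w₂)).Nonempty) :
    T.hull (Set.range w₁) = T.hull (Set.range w₂) :=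
  (hull_subset (isConvex_hull _) (hT.range_subset_hull hG h₁ h₂ hτ₁ hc₁ hc₂ hmeet)).antisymm
    (hull_subset (isConvex_hull _) (hT.range_subset_hull hG h₂ h₁ hτ₂ hc₂ hc₁
      (by rwa [Set.inter_comm])))

end CubeComplex

/-! ### Geodesic segments and thin polygons -/

section Segments

variable {Υ : Type w} [MetricSpace Υ]

theorem isGeodesicSegment_image {c : ℝ → Υ} {a b s t : ℝ}
    (hc : ∀ s ∈ Set.Icc a b, ∀ t ∈ Set.Icc a b, dist (c s) (c t) = |s - t|)
    (hs : a ≤ s) (hst : s ≤ t) (ht : t ≤ b) : IsGeodesicSegment (c '' Set.Icc s t) (c s) (c t) := by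
  have hd : dist (c s) (c t) = t - s := by
    rw [hc s ⟨hs, by linarith⟩ t ⟨by linarith, ht⟩, abs_sub_comm, abs_of_nonneg (by linarith)]
  refine ⟨fun r => c (s + r), by simp, by simp [hd], ?_, ?_⟩
  · rw [hd]
    intro r hr r' hr'
    rw [hc _ ⟨by linarith [hr.1], by linarith [hr.2]⟩ _ ⟨by linarith [hr'.1], by linarith [hr'.2]⟩]
    congr 1; ring
  · rw [hd]
    ext y
    constructor
    · rintro ⟨r, hr, rfl⟩
      exact ⟨r - s, ⟨by linarith [hr.1], by linarith [hr.2]⟩, by simp⟩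
    · rintro ⟨r, hr, rfl⟩
      exact ⟨s + r, ⟨by linarith [hr.1], by linarith [hr.2]⟩, rfl⟩

namespace IsGeodesicSegment

variable {A : Set Υ} {x y : Υ}

theorem symm (h : IsGeodesicSegment A x y) : IsGeodesicSegment A y x := by
  obtain ⟨c, h0, h1, hc, rfl⟩ := h
  refine ⟨fun t => c (dist x y - t), by simp [h1], by simp [dist_comm y x, h0], ?_, ?_⟩
  · rw [dist_comm y x]
    intro s hs t ht
    rw [hc _ ⟨by linarith [hs.2], by linarith [hs.1]⟩ _ ⟨by linarith [ht.2], by linarith [ht.1]⟩,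
      abs_sub_comm]
    congr 1; ring
  · rw [dist_comm y x]
    ext z
    constructor <;> rintro ⟨r, hr, rfl⟩ <;>
      exact ⟨dist x y - r, ⟨by linarith [hr.2], by linarith [hr.1]⟩, by simp⟩

theorem left_mem (h : IsGeodesicSegment A x y) : x ∈ A := by
  obtain ⟨c, h0, h1, hc, rfl⟩ := h
  exact ⟨0, ⟨le_rfl, dist_nonneg⟩, h0⟩

theorem right_mem (h : IsGeodesicSegment A x y) : y ∈ A := h.symm.left_mem

theorem dist_add_dist (h : IsGeodesicSegment A x y) {a : Υ} (ha : a ∈ A) :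
    dist x a + dist a y = dist x y := by
  obtain ⟨c, h0, h1, hc, rfl⟩ := h
  obtain ⟨t, ht, rfl⟩ := ha
  have e0 := hc 0 ⟨le_rfl, dist_nonneg⟩ t ht
  have e1 := hc t ht (dist x y) ⟨dist_nonneg, le_rfl⟩
  rw [h0, zero_sub, abs_neg, abs_of_nonneg ht.1] at e0
  rw [h1, abs_sub_comm, abs_of_nonneg (by linarith [ht.2])] at e1
  linarith

theorem dist_le (h : IsGeodesicSegment A x y) {a : Υ} (ha : a ∈ A) : dist x a ≤ dist x y := by
  have := h.dist_add_dist ha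
  have := dist_nonneg (x := a) (y := y)
  linarith

theorem exists_subset (h : IsGeodesicSegment A x y) {a b : Υ} (ha : a ∈ A) (hb : b ∈ A) :
    ∃ B ⊆ A, IsGeodesicSegment B a b := by
  obtain ⟨c, h0, h1, hc, rfl⟩ := h
  obtain ⟨s, hs, rfl⟩ := ha
  obtain ⟨t, ht, rfl⟩ := hb
  rcases le_total s t with hst | hst
  · exact ⟨_, Set.image_mono (Set.Icc_subset_Icc hs.1 ht.2),
      isGeodesicSegment_image hc hs.1 hst ht.2⟩
  · exact ⟨_, Set.image_mono (Set.Icc_subset_Icc ht.1 hs.2),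
      (isGeodesicSegment_image hc ht.1 hst hs.2).symm⟩

theorem continuousOn_of_dist {c : ℝ → Υ} {S : Set ℝ}
    (hc : ∀ s ∈ S, ∀ t ∈ S, dist (c s) (c t) = |s - t|) : ContinuousOn c S := by
  rw [Metric.continuousOn_iff]
  intro t ht ε hε
  exact ⟨ε, hε, fun s hs hst => by rwa [hc s hs t ht]⟩

theorem isCompact (h : IsGeodesicSegment A x y) : IsCompact A := by
  obtain ⟨c, h0, h1, hc, rfl⟩ := h
  exact isCompact_Icc.image_of_continuousOn (continuousOn_of_dist hc)

theorem isPreconnected (h : IsGeodesicSegment A x y) : IsPreconnected A := by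
  obtain ⟨c, h0, h1, hc, rfl⟩ := h
  exact isPreconnected_Icc.image _ (continuousOn_of_dist hc)

theorem smul {G : Type v} [Group G] [MulAction G Υ] [IsIsometricSMul G Υ]
    (h : IsGeodesicSegment A x y) (g : G) : IsGeodesicSegment (g • A) (g • x) (g • y) := by
  obtain ⟨c, h0, h1, hc, rfl⟩ := h
  refine ⟨fun t => g • c t, by simp [h0], by simp [h1], ?_, ?_⟩
  · rw [dist_smul]
    intro s hs t ht
    rw [dist_smul, hc s hs t ht]
  · rw [dist_smul, ← Set.image_smul, Set.image_image]

end IsGeodesicSegment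

theorem Isometry.isGeodesicSegment {γ : ℝ → Υ} (hγ : Isometry γ) (s t : ℝ) :
    IsGeodesicSegment (γ '' Set.uIcc s t) (γ s) (γ t) := by
  have key : ∀ s t : ℝ, s ≤ t → IsGeodesicSegment (γ '' Set.Icc s t) (γ s) (γ t) := fun s t hst =>
    isGeodesicSegment_image (fun a _ b _ => by rw [hγ.dist_eq, Real.dist_eq]) le_rfl hst le_rfl
  rcases le_total s t with hst | hst
  · rw [Set.uIcc_of_le hst]; exact key s t hst
  · rw [Set.uIcc_of_ge hst]; exact (key t s hst).symm

variable {δ : ℝ}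

theorem IsHyperbolicSpace.nonneg (hδ : IsHyperbolicSpace Υ δ) (x : Υ) : 0 ≤ δ := by
  have h : IsGeodesicSegment {x} x x := by
    refine ⟨fun _ => x, rfl, rfl, ?_, ?_⟩
    · simp
    · simp
  obtain ⟨b, -, hb⟩ := hδ x x x _ _ _ h h h x rfl
  exact dist_nonneg.trans hb

/-- Geodesic quadrilaterals are `2δ`-thin. -/
theorem IsHyperbolicSpace.quadrilateral (hδ : IsHyperbolicSpace Υ δ) (hΥ : IsGeodesicSpace Υ)
    {x y x' y' a : Υ} {A A' P Q : Set Υ} (hA : IsGeodesicSegment A x y)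
    (hA' : IsGeodesicSegment A' x' y') (hP : IsGeodesicSegment P x x')
    (hQ : IsGeodesicSegment Q y y') (ha : a ∈ A) :
    ∃ b, (b ∈ A' ∨ b ∈ P ∨ b ∈ Q) ∧ dist a b ≤ 2 * δ := by
  have h0 := hδ.nonneg x
  obtain ⟨D, hD⟩ := hΥ y x'
  obtain ⟨b, hb | hb, hab⟩ := hδ _ _ _ _ _ _ hA hD hP.symm a ha
  · obtain ⟨b', hb', hbb'⟩ := hδ _ _ _ _ _ _ hD hA' hQ.symm b hb
    have := dist_triangle a b b'
    refine ⟨b', ?_, by linarith⟩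
    rcases hb' with hb' | hb'
    · exact Or.inl hb'
    · exact Or.inr (Or.inr hb')
  · exact ⟨b, Or.inr (Or.inl hb), by linarith⟩

/-- Geodesics with nearby endpoints are `2δ`-close away from the endpoints. -/
theorem IsHyperbolicSpace.exists_dist_le (hδ : IsHyperbolicSpace Υ δ) (hΥ : IsGeodesicSpace Υ)
    {x y x' y' a : Υ} {A A' : Set Υ} {E : ℝ} (hA : IsGeodesicSegment A x y)
    (hA' : IsGeodesicSegment A' x' y') (hx : dist x x' ≤ E) (hy : dist y y' ≤ E) (ha : a ∈ A)
    (hax : E + 2 * δ < dist a x) (hay : E + 2 * δ < dist a y) : ∃ b ∈ A', dist a b ≤ 2 * δ := by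
  obtain ⟨P, hP⟩ := hΥ x x'
  obtain ⟨Q, hQ⟩ := hΥ y y'
  obtain ⟨b, hb | hb | hb, hab⟩ := hδ.quadrilateral hΥ hA hA' hP hQ ha
  · exact ⟨b, hb, hab⟩
  · have h1 := hP.dist_le hb
    have h2 := dist_triangle_right a x b
    linarith
  · have h1 := hQ.dist_le hb
    have h2 := dist_triangle_right a y b
    linarith

/-- A point that stays close to segments whose endpoints run away along the line `γ` is close to
`γ`. -/
theorem IsHyperbolicSpace.exists_dist_line_le (hδ : IsHyperbolicSpace Υ δ) (hΥ : IsGeodesicSpace Υ)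
    {γ : ℝ → Υ} (hγ : Isometry γ) {q : Υ} {B D : ℝ}
    (h : ∀ R : ℝ, ∃ s t x y A, IsGeodesicSegment A x y ∧ dist x (γ s) ≤ B ∧ dist y (γ t) ≤ B ∧
      R ≤ dist q (γ s) ∧ R ≤ dist q (γ t) ∧ ∃ a ∈ A, dist q a ≤ D) :
    ∃ r, dist q (γ r) ≤ D + 2 * δ := by
  obtain ⟨s, t, x, y, A, hA, hx, hy, hs, ht, a, ha, hqa⟩ := h (D + 2 * B + 2 * δ + 1)
  have h1 := dist_triangle4 q a x (γ s)
  have h2 := dist_triangle4 q a y (γ t)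
  obtain ⟨_, ⟨r, -, rfl⟩, hr⟩ := hδ.exists_dist_le hΥ hA (hγ.isGeodesicSegment s t) hx hy ha
    (by linarith) (by linarith)
  exact ⟨r, by linarith [dist_triangle q a (γ r)]⟩

/-- If the points of a line `γ` that are `2δ`-close to the segment `S` have mutual distance at most
`L`, then so have, up to an additive constant, the points of `γ` that are `E`-close to `S`. -/
theorem IsHyperbolicSpace.overlap_le (hδ : IsHyperbolicSpace Υ δ) (hΥ : IsGeodesicSpace Υ)
    {γ : ℝ → Υ} (hγ : Isometry γ) {x y u v : Υ} {S : Set Υ} (hS : IsGeodesicSegment S x y)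
    {L E s t : ℝ} (hL : 0 ≤ L)
    (hbound : ∀ r r', (∃ b ∈ S, dist (γ r) b ≤ 2 * δ) → (∃ b ∈ S, dist (γ r') b ≤ 2 * δ) →
      |r - r'| ≤ L)
    (hu : u ∈ S) (hv : v ∈ S) (hsu : dist (γ s) u ≤ E) (htv : dist (γ t) v ≤ E) :
    |s - t| ≤ L + 2 * E + 4 * δ + 2 := by
  wlog hst : s ≤ t generalizing s t u v
  · rw [abs_sub_comm]
    exact this hv hu htv hsu (by linarith)
  have h0 := hδ.nonneg x
  have hE : 0 ≤ E := dist_nonneg.trans hsu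
  rw [abs_sub_comm, abs_of_nonneg (by linarith)]
  by_contra! hlt
  obtain ⟨S', hS', hseg⟩ := hS.exists_subset hu hv
  have key : ∀ r, s + E + 2 * δ < r → r < t - E - 2 * δ → ∃ b ∈ S, dist (γ r) b ≤ 2 * δ := by
    intro r h1 h2
    have hr : γ r ∈ γ '' Set.uIcc s t := by
      rw [Set.uIcc_of_le hst]
      exact ⟨r, ⟨by linarith, by linarith⟩, rfl⟩
    obtain ⟨b, hb, hrb⟩ := hδ.exists_dist_le hΥ (hγ.isGeodesicSegment s t) hseg hsu htv hr
      (by rw [hγ.dist_eq, Real.dist_eq, abs_of_nonneg] <;> linarith)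
      (by rw [hγ.dist_eq, Real.dist_eq, abs_sub_comm, abs_of_nonneg] <;> linarith)
    exact ⟨b, hS' hb, hrb⟩
  have := hbound (s + E + 2 * δ + 1 / 2) (t - E - 2 * δ - 1 / 2) (key _ (by linarith) (by linarith))
    (key _ (by linarith) (by linarith))
  rw [abs_sub_comm, abs_of_nonneg (by linarith)] at this
  linarith

/-! ### Stability of quasi-geodesics -/

/-- `c 0, …, c N` is a discrete quasi-geodesic with constant `K`. -/
def IsQuasiGeodesic (K : ℝ) (N : ℕ) (c : ℕ → Υ) : Prop :=
  (∀ i < N, dist (c i) (c (i + 1)) ≤ K) ∧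
    ∀ i ≤ N, ∀ j ≤ N, |(i : ℝ) - j| ≤ K * dist (c i) (c j) + K

/-- Geodesics are logarithmically close to paths with the same endpoints. -/
theorem IsHyperbolicSpace.near_path (hδ : IsHyperbolicSpace Υ δ) (hΥ : IsGeodesicSpace Υ) {K : ℝ}
    (hK : 0 ≤ K) (k N : ℕ) (hN : N ≤ 2 ^ k) (c : ℕ → Υ)
    (hc : ∀ i < N, dist (c i) (c (i + 1)) ≤ K) {A : Set Υ}
    (hA : IsGeodesicSegment A (c 0) (c N)) {a : Υ} (ha : a ∈ A) :
    ∃ i ≤ N, dist a (c i) ≤ δ * k + K := by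
  induction k generalizing N c A a with
  | zero =>
    refine ⟨0, Nat.zero_le _, ?_⟩
    have h1 := hA.dist_le ha
    rw [dist_comm]
    have hN' : N = 0 ∨ N = 1 := by simp at hN; omega
    rcases hN' with rfl | rfl
    · simp at h1; simp [h1, hK]
    · have := hc 0 (by norm_num)
      simp at *; linarith
  | succ k ih =>
    have h0 := hδ.nonneg a
    rw [pow_succ] at hN
    obtain ⟨M, hM, hM1, hM2⟩ : ∃ M, M ≤ N ∧ M ≤ 2 ^ k ∧ N - M ≤ 2 ^ k :=
      ⟨min N (2 ^ k), by omega, by omega, by omega⟩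
    obtain ⟨B, hB⟩ := hΥ (c M) (c N)
    obtain ⟨C, hC⟩ := hΥ (c 0) (c M)
    push_cast
    obtain ⟨b, hb | hb, hab⟩ := hδ _ _ _ _ _ _ hA hB.symm hC.symm a ha
    · obtain ⟨i, hi, hbi⟩ := ih (N - M) hM2 (fun i => c (M + i))
        (fun i hi => hc (M + i) (by omega)) (A := B)
        (by rwa [add_zero, Nat.add_sub_cancel' hM]) hb
      exact ⟨M + i, by omega, by linarith [dist_triangle a b (c (M + i))]⟩
    · obtain ⟨i, hi, hbi⟩ := ih M hM1 c (fun i hi => hc i (by omega)) hC hb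
      exact ⟨i, by omega, by linarith [dist_triangle a b (c i)]⟩

theorem IsHyperbolicSpace.near_path_of_mem (hδ : IsHyperbolicSpace Υ δ) (hΥ : IsGeodesicSpace Υ)
    {K : ℝ} (hK : 0 ≤ K) {N : ℕ} {c : ℕ → Υ} (hc : ∀ i < N, dist (c i) (c (i + 1)) ≤ K)
    {i j k : ℕ} (hi : i ≤ N) (hj : j ≤ N) (hk : |(i : ℝ) - j| ≤ 2 ^ k) {A : Set Υ}
    (hA : IsGeodesicSegment A (c i) (c j)) {a : Υ} (ha : a ∈ A) :
    ∃ m ≤ N, dist a (c m) ≤ δ * k + K := by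
  wlog hij : i ≤ j generalizing i j
  · exact this hj hi (by rwa [abs_sub_comm]) hA.symm (by omega)
  have hk' : j - i ≤ 2 ^ k := by
    rw [abs_sub_comm, abs_of_nonneg (by simpa using hij), ← Nat.cast_sub hij] at hk
    exact_mod_cast hk
  obtain ⟨m, hm, ham⟩ := hδ.near_path hΥ hK k (j - i) hk' (fun m => c (i + m))
    (fun m hm => hc (i + m) (by omega)) (by rwa [add_zero, Nat.add_sub_cancel' hij]) ha
  exact ⟨i + m, by omega, ham⟩

theorem exists_linear_lt_two_pow (a b : ℝ) : ∃ k₀ : ℕ, ∀ k ≥ k₀, a + b * k < 2 ^ k := by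
  have h1 := tendsto_pow_const_div_const_pow_of_one_lt 1 (one_lt_two : (1 : ℝ) < 2)
  have h0 := tendsto_pow_const_div_const_pow_of_one_lt 0 (one_lt_two : (1 : ℝ) < 2)
  have h := (h0.const_mul a).add (h1.const_mul b)
  simp only [mul_zero, add_zero] at h
  obtain ⟨k₀, hk₀⟩ := eventually_atTop.1 (h.eventually (gt_mem_nhds one_pos))
  refine ⟨k₀, fun k hk => ?_⟩
  have := hk₀ k hk
  have hpos : (0 : ℝ) < 2 ^ k := by positivity
  rw [pow_zero, pow_one, ← mul_div_assoc, ← mul_div_assoc, ← add_div, div_lt_one hpos] at this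
  linarith

/-- Geodesics are uniformly close to quasi-geodesics with the same endpoints. -/
theorem exists_geodesic_near_quasiGeodesic (δ K : ℝ) (hK : 0 ≤ K) :
    ∃ D : ℝ, ∀ (Υ : Type w) [MetricSpace Υ], IsGeodesicSpace Υ → IsHyperbolicSpace Υ δ →
      ∀ (N : ℕ) (c : ℕ → Υ), IsQuasiGeodesic K N c → ∀ A, IsGeodesicSegment A (c 0) (c N) →
        ∀ a ∈ A, ∃ i ≤ N, dist a (c i) ≤ D := by
  obtain ⟨k₀, hk₀⟩ := exists_linear_lt_two_pow (6 * K * (2 * δ + K + δ) + K) (6 * K * δ)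
  refine ⟨2 * δ + K + δ * k₀, fun Υ _ hΥ hδ N c hc A hA a₁ ha₁ => ?_⟩
  have h0 := hδ.nonneg (c 0)
  have hk0 : 0 ≤ δ * k₀ := by positivity
  set I : Set Υ := c '' Set.Iic N with hI
  have hIne : I.Nonempty := ⟨c 0, 0, by simp, rfl⟩
  have hIc : IsCompact I := ((Set.finite_Iic N).image c).isCompact
  -- the point of `A` farthest from the quasi-geodesic, and its distance `S`
  obtain ⟨a₀, ha₀, hmax⟩ := hA.isCompact.exists_isMaxOn ⟨_, hA.left_mem⟩
    (Metric.continuous_infDist_pt I).continuousOn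
  set S := Metric.infDist a₀ I with hS
  have hS0 : 0 ≤ S := Metric.infDist_nonneg
  have hnear : ∀ a ∈ A, ∃ i ≤ N, dist a (c i) ≤ S := by
    intro a ha
    obtain ⟨_, ⟨i, hi, rfl⟩, h⟩ := hIc.exists_infDist_eq_dist hIne a
    exact ⟨i, hi, by rw [← h]; exact hmax ha⟩
  have hSle : ∀ i ≤ N, S ≤ dist a₀ (c i) := fun i hi =>
    Metric.infDist_le_dist_of_mem ⟨i, hi, rfl⟩
  suffices S ≤ 2 * δ + K + δ * k₀ by
    obtain ⟨i, hi, h⟩ := hnear a₁ ha₁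
    exact ⟨i, hi, h.trans this⟩
  obtain ⟨γ, hγ0, hγ1, hγ, rfl⟩ := hA
  set ℓ := dist (c 0) (c N)
  have hℓ : 0 ≤ ℓ := dist_nonneg
  obtain ⟨t₀, ht₀, rfl⟩ := ha₀
  -- two points of `A` at distance `2 S` on both sides, or endpoints of `A`
  obtain ⟨t₁, h1, h1', h1'', i, hi, hyi, hyi'⟩ : ∃ t₁, 0 ≤ t₁ ∧ t₁ ≤ t₀ ∧ t₀ - t₁ ≤ 2 * S ∧
      ∃ i ≤ N, dist (γ t₁) (c i) ≤ S ∧ (γ t₁ = c i ∨ t₀ - t₁ = 2 * S) := by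
    rcases le_total (t₀ - 2 * S) 0 with h | h
    · exact ⟨0, le_rfl, ht₀.1, by linarith, 0, Nat.zero_le _, by rw [hγ0, dist_self]; exact hS0,
        Or.inl hγ0⟩
    · obtain ⟨i, hi, h'⟩ := hnear (γ (t₀ - 2 * S)) ⟨_, ⟨h, by linarith [ht₀.2]⟩, rfl⟩
      exact ⟨t₀ - 2 * S, h, by linarith, by linarith, i, hi, h', Or.inr (by ring)⟩
  obtain ⟨t₂, h2, h2', h2'', j, hj, hzj, hzj'⟩ : ∃ t₂, t₂ ≤ ℓ ∧ t₀ ≤ t₂ ∧ t₂ - t₀ ≤ 2 * S ∧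
      ∃ j ≤ N, dist (γ t₂) (c j) ≤ S ∧ (γ t₂ = c j ∨ t₂ - t₀ = 2 * S) := by
    rcases le_total ℓ (t₀ + 2 * S) with h | h
    · exact ⟨ℓ, le_rfl, ht₀.2, by linarith, N, le_rfl, by rw [hγ1, dist_self]; exact hS0,
        Or.inl hγ1⟩
    · obtain ⟨j, hj, h'⟩ := hnear (γ (t₀ + 2 * S)) ⟨_, ⟨by linarith [ht₀.1], h⟩, rfl⟩
      exact ⟨t₀ + 2 * S, h, by linarith, by linarith, j, hj, h', Or.inr (by ring)⟩
  have hd : dist (γ t₁) (γ t₂) ≤ 4 * S := by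
    rw [hγ _ ⟨h1, by linarith⟩ _ ⟨by linarith, h2⟩, abs_sub_comm, abs_of_nonneg] <;> linarith
  have hd1 : dist (γ t₀) (γ t₁) = t₀ - t₁ := by
    rw [hγ _ ht₀ _ ⟨h1, by linarith⟩, abs_of_nonneg]; linarith
  have hd2 : dist (γ t₀) (γ t₂) = t₂ - t₀ := by
    rw [hγ _ ht₀ _ ⟨by linarith, h2⟩, abs_sub_comm, abs_of_nonneg]; linarith
  obtain ⟨B, hB⟩ := hΥ (c i) (c j)
  obtain ⟨P, hP⟩ := hΥ (γ t₁) (c i)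
  obtain ⟨Q, hQ⟩ := hΥ (γ t₂) (c j)
  have hside : ∀ (t : ℝ) (P : Set Υ) (i : ℕ) (b : Υ), i ≤ N → IsGeodesicSegment P (γ t) (c i) →
      dist (γ t) (c i) ≤ S → (γ t = c i ∨ dist (γ t₀) (γ t) = 2 * S) → b ∈ P →
      dist (γ t₀) b ≤ 2 * δ → S ≤ 2 * δ := by
    intro t P i b hi hP hti hor hb hab
    have hb' := hP.dist_le hb
    rcases hor with h | h
    · rw [h, dist_self] at hb'
      have := dist_triangle (γ t₀) b (c i)
      rw [dist_comm b] at this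
      linarith [hSle i hi]
    · linarith [dist_triangle_right (γ t₀) (γ t) b]
  obtain ⟨b, hb | hb | hb, hab⟩ := hδ.quadrilateral hΥ
    (isGeodesicSegment_image hγ h1 (h1'.trans h2') h2) hB hP hQ ⟨t₀, ⟨h1', h2'⟩, rfl⟩
  · have hij : |(i : ℝ) - j| ≤ 6 * K * S + K := by
      have h3 := hc.2 i hi j hj
      have h4 : dist (c i) (c j) ≤ 6 * S := by
        have := dist_triangle4 (c i) (γ t₁) (γ t₂) (c j)
        rw [dist_comm (c i) (γ t₁)] at this
        linarith
      nlinarith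
    set n : ℕ := ((i : ℤ) - j).natAbs with hn
    have hn' : (n : ℝ) = |(i : ℝ) - j| := by
      rw [hn, Nat.cast_natAbs]; push_cast; rfl
    have hnk : |(i : ℝ) - j| ≤ 2 ^ Nat.clog 2 n := by
      rw [← hn']
      exact_mod_cast Nat.le_pow_clog (by norm_num) n
    obtain ⟨m, hm, hbm⟩ := hδ.near_path_of_mem hΥ hK hc.1 hi hj hnk hB hb
    have hSk : S ≤ 2 * δ + K + δ * Nat.clog 2 n := by
      linarith [hSle m hm, dist_triangle (γ t₀) b (c m)]
    have hk : Nat.clog 2 n ≤ k₀ := by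
      by_contra! hlt
      obtain ⟨k, hk⟩ : ∃ k, Nat.clog 2 n = k + 1 := ⟨Nat.clog 2 n - 1, by omega⟩
      have h1n : 1 < n := by
        by_contra! h
        rw [Nat.clog_of_right_le_one h] at hk
        omega
      have h3 := Nat.pow_pred_clog_lt_self (b := 2) (by norm_num) h1n
      rw [hk, Nat.pred_succ] at h3
      have h4 : (2 : ℝ) ^ k < n := by exact_mod_cast h3
      have h5 := hk₀ k (by omega)
      rw [hk] at hSk
      push_cast at hSk
      have : 6 * K * S ≤ 6 * K * (2 * δ + K + δ * (k + 1)) := by gcongr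
      linarith
    have : δ * Nat.clog 2 n ≤ δ * k₀ := by gcongr
    linarith
  · linarith [hside t₁ P i b hi hP hyi (by rwa [hd1]) hb hab]
  · linarith [hside t₂ Q j b hj hQ hzj (by rwa [hd2]) hb hab]

theorem IsQuasiGeodesic.dist_le {K : ℝ} {N : ℕ} {c : ℕ → Υ} (hc : IsQuasiGeodesic K N c)
    {i j : ℕ} (hij : i ≤ j) (hj : j ≤ N) : dist (c i) (c j) ≤ K * (j - i) := by
  induction j, hij using Nat.le_induction with
  | base => simp
  | succ j hij ih =>
    have h1 := ih (by omega)
    have h2 := hc.1 j (by omega)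
    have h3 := dist_triangle (c i) (c j) (c (j + 1))
    push_cast
    linarith

/-- Quasi-geodesics are uniformly close to geodesics with the same endpoints. -/
theorem exists_quasiGeodesic_near_geodesic (δ K : ℝ) (hK : 0 ≤ K) :
    ∃ D : ℝ, ∀ (Υ : Type w) [MetricSpace Υ], IsGeodesicSpace Υ → IsHyperbolicSpace Υ δ →
      ∀ (N : ℕ) (c : ℕ → Υ), IsQuasiGeodesic K N c → ∀ A, IsGeodesicSegment A (c 0) (c N) →
        ∀ i ≤ N, ∃ a ∈ A, dist (c i) a ≤ D := by
  obtain ⟨D, hD⟩ := exists_geodesic_near_quasiGeodesic.{w} δ K hK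
  refine ⟨D + K * (2 * K * D + K), fun Υ _ hΥ hδ N c hc A hA i hi => ?_⟩
  have hD0 : 0 ≤ D := by
    obtain ⟨j, -, hj⟩ := hD Υ hΥ hδ N c hc A hA _ hA.left_mem
    exact dist_nonneg.trans hj
  -- by connectedness some point of `A` is close to both halves of the quasi-geodesic
  have hclosed : ∀ s : Set ℕ, s.Finite → IsClosed (⋃ m ∈ s, Metric.closedBall (c m) D) :=
    fun s hs => hs.isClosed_biUnion fun _ _ => Metric.isClosed_closedBall
  obtain ⟨a, ha, h1, h2⟩ := isPreconnected_closed_iff.1 hA.isPreconnected _ _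
    (hclosed _ (Set.finite_Icc 0 i)) (hclosed _ (Set.finite_Icc i N))
    (by
      intro a ha
      obtain ⟨m, hm, ham⟩ := hD Υ hΥ hδ N c hc A hA a ha
      simp only [Set.mem_union, Set.mem_iUnion]
      rcases le_total m i with h | h
      · exact Or.inl ⟨m, ⟨Nat.zero_le _, h⟩, ham⟩
      · exact Or.inr ⟨m, ⟨h, hm⟩, ham⟩)
    ⟨c 0, hA.left_mem, by
      simp only [Set.mem_iUnion]
      exact ⟨0, ⟨le_rfl, Nat.zero_le _⟩, by simpa using hD0⟩⟩
    ⟨c N, hA.right_mem, by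
      simp only [Set.mem_iUnion]
      exact ⟨N, ⟨hi, le_rfl⟩, by simpa using hD0⟩⟩
  simp only [Set.mem_iUnion] at h1 h2
  obtain ⟨m, hm, ham⟩ := h1
  obtain ⟨m', hm', ham'⟩ := h2
  rw [Metric.mem_closedBall] at ham ham'
  refine ⟨a, ha, ?_⟩
  have h3 := hc.2 m (hm.2.trans hi) m' hm'.2
  have h4 := hc.dist_le hm.2 hi
  have h5 : dist (c m) (c m') ≤ 2 * D := by
    linarith [dist_triangle_left (c m) (c m') a]
  have h6 : (i : ℝ) - m ≤ 2 * K * D + K := by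
    have h7 : (i : ℝ) ≤ m' := by exact_mod_cast hm'.1
    have h8 := (abs_le.1 h3).1
    nlinarith
  have h9 : K * ((i : ℝ) - m) ≤ K * (2 * K * D + K) := by gcongr
  have := dist_triangle (c i) (c m) a
  rw [dist_comm (c i) (c m), dist_comm (c m) a] at this
  linarith

end Segments

/-! ### Hyperplane stabilizers and carriers -/

namespace CubeComplex

variable {V : Type u} {T : CubeComplex V} {G : Type v} [Group G] [MulAction G V]

theorem IsHyperplane.edge_mem {U : Set (Sym2 V)} (hU : T.IsHyperplane U) {e : Sym2 V}
    (he : e ∈ U) : e ∈ T.graph.edgeSet := by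
  obtain ⟨e₀, he₀, rfl⟩ := hU
  have key : ∀ e f, Relation.EqvGen T.Opposite e f →
      (e ∈ T.graph.edgeSet ↔ f ∈ T.graph.edgeSet) := by
    intro e f h
    induction h with
    | rel e f h =>
      obtain ⟨a, b, c, d, hsq, rfl, rfl⟩ := h
      exact iff_of_true hsq.2.1 hsq.2.2.2.1.symm
    | refl => rfl
    | symm _ _ _ ih => exact ih.symm
    | trans _ _ _ _ _ ih1 ih2 => exact ih1.trans ih2
  exact (key _ _ he).1 he₀

theorem IsDeckAction.isSquare_smul (hG : T.IsDeckAction G) (g : G) {a b c d : V}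
    (h : T.IsSquare a b c d) : T.IsSquare (g • a) (g • b) (g • c) (g • d) := by
  refine ⟨?_, hG.adj_smul g h.2.1, hG.adj_smul g h.2.2.1, hG.adj_smul g h.2.2.2.1,
    hG.adj_smul g h.2.2.2.2⟩
  have := hG.smul_mem g _ h.1
  rwa [← Set.image_smul, Set.image_insert_eq, Set.image_insert_eq, Set.image_pair] at this

theorem IsDeckAction.eqvGen_smul (hG : T.IsDeckAction G) (g : G) {e f : Sym2 V}
    (h : Relation.EqvGen T.Opposite e f) :
    Relation.EqvGen T.Opposite (Sym2.map (fun x => g • x) e) (Sym2.map (fun x => g • x) f) := by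
  induction h with
  | rel e f h =>
    obtain ⟨a, b, c, d, hsq, rfl, rfl⟩ := h
    exact .rel _ _ ⟨_, _, _, _, hG.isSquare_smul g hsq, rfl, rfl⟩
  | refl => exact .refl _
  | symm _ _ _ ih => exact .symm _ _ ih
  | trans _ _ _ _ _ ih1 ih2 => exact .trans _ _ _ ih1 ih2

theorem IsDeckAction.translate_subset (hG : T.IsDeckAction G) {U : Set (Sym2 V)}
    (hU : T.IsHyperplane U) {g : G} {e : Sym2 V} (he : e ∈ U)
    (hge : Sym2.map (fun x => g • x) e ∈ U) : translate g U ⊆ U := by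
  obtain ⟨e₀, -, rfl⟩ := hU
  rintro _ ⟨f, hf, rfl⟩
  exact .trans _ _ _ hge (hG.eqvGen_smul g (.trans _ _ _ (.symm _ _ he) hf))

/-- An element that maps one edge dual to `U` to another stabilizes `U`. -/
theorem IsDeckAction.mem_hyperplaneStabilizer (hG : T.IsDeckAction G) {U : Set (Sym2 V)}
    (hU : T.IsHyperplane U) {g : G} {e : Sym2 V} (he : e ∈ U)
    (hge : Sym2.map (fun x => g • x) e ∈ U) : g ∈ hyperplaneStabilizer G U := by
  refine (hG.translate_subset hU he hge).antisymm fun f hf => ?_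
  have hinv : ∀ e : Sym2 V, Sym2.map (fun x => g⁻¹ • x) (Sym2.map (fun x => g • x) e) = e := by
    intro e; simp [Sym2.map_map]
  refine ⟨Sym2.map (fun x => g⁻¹ • x) f, ?_, by simp [Sym2.map_map]⟩
  exact hG.translate_subset hU hge (by rwa [hinv]) ⟨f, hf, rfl⟩

/-- The stabilizer of a hyperplane acts cofinitely on the vertices of its carrier. -/
theorem IsDeckAction.exists_finite_carrier (hG : T.IsDeckAction G) {U : Set (Sym2 V)}
    (hU : T.IsHyperplane U) : ∃ F : Set V, F.Finite ∧
      ∀ x ∈ carrier U, ∃ h ∈ hyperplaneStabilizer G U, ∃ y ∈ F, h • y = x := by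
  obtain ⟨S, hS, hcov⟩ := hG.cocompact
  have hrep : ∀ D : Set V, ∃ P : V × V, (∃ g : G, ∃ x y, s(x, y) ∈ U ∧ g • D = {x, y}) →
      s(P.1, P.2) ∈ U ∧ ∃ g : G, g • D = {P.1, P.2} := by
    intro D
    by_cases h : ∃ g : G, ∃ x y, s(x, y) ∈ U ∧ g • D = {x, y}
    · obtain ⟨g, x, y, h1, h2⟩ := h
      exact ⟨(x, y), fun _ => ⟨h1, g, h2⟩⟩
    · obtain ⟨e, he, -⟩ := hU
      induction e with
      | _ x y => exact ⟨(x, y), fun h' => absurd h' h⟩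
  choose P hP using hrep
  refine ⟨⋃ D ∈ S, {(P D).1, (P D).2}, hS.biUnion fun _ _ => by simp, ?_⟩
  rintro x ⟨e, he, hx⟩
  obtain ⟨y, rfl⟩ := hx
  obtain ⟨g, D, hD, hgD⟩ := hcov _ (hU.edge_mem he).2
  obtain ⟨h1, g₀, hg₀⟩ := hP D ⟨g, x, y, he, hgD⟩
  have hpair : ({(g * g₀⁻¹) • (P D).1, (g * g₀⁻¹) • (P D).2} : Set V) = {x, y} := by
    rw [← hgD, ← Set.image_pair (fun z => (g * g₀⁻¹) • z), Set.image_smul, ← hg₀, mul_smul,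
      inv_smul_smul]
  refine ⟨g * g₀⁻¹, hG.mem_hyperplaneStabilizer hU h1 ?_, ?_⟩
  · rw [Sym2.map_mk]
    convert he using 1
    rw [Sym2.eq_iff]
    exact Set.pair_eq_pair_iff.1 hpair
  · rcases Set.pair_eq_pair_iff.1 hpair with ⟨h, -⟩ | ⟨-, h⟩
    · exact ⟨_, Set.mem_biUnion hD (by simp), h⟩
    · exact ⟨_, Set.mem_biUnion hD (by simp), h⟩

theorem mem_carrier_translate {U : Set (Sym2 V)} {g : G} {x : V}
    (hx : x ∈ carrier (translate g U)) : ∃ y ∈ carrier U, g • y = x := by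
  obtain ⟨_, ⟨e, he, rfl⟩, hx⟩ := hx
  obtain ⟨y, hy, rfl⟩ := Sym2.mem_map.1 hx
  exact ⟨y, ⟨e, he, hy⟩, rfl⟩

theorem IsHyperplane.carrier_nonempty {U : Set (Sym2 V)} (hU : T.IsHyperplane U) :
    (carrier U).Nonempty := by
  obtain ⟨e, -, rfl⟩ := hU
  induction e with
  | _ x y => exact ⟨x, s(x, y), .refl _, by simp⟩

/-! ### Translation lengths -/

theorem IsDeckAction.dist_pow_smul_le (hG : T.IsDeckAction G) (hc : T.graph.Connected) (g : G)
    (x : V) (n : ℕ) : T.graph.dist x (g ^ n • x) ≤ n * T.graph.dist x (g • x) := by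
  induction n with
  | zero => simp
  | succ n ih =>
    have h := hc.dist_triangle (u := x) (v := g ^ n • x) (w := g ^ (n + 1) • x)
    rw [pow_succ, mul_smul, hG.dist_smul hc] at h
    rw [pow_succ, mul_smul, add_mul, one_mul]
    omega

theorem IsDeckAction.dist_zpow_smul (hG : T.IsDeckAction G) (hc : T.graph.Connected) (g : G)
    (x : V) (m n : ℤ) :
    T.graph.dist (g ^ m • x) (g ^ n • x) = T.graph.dist x (g ^ (m - n).natAbs • x) := by
  rcases le_total m n with h | h
  · rw [← hG.dist_smul hc (g ^ m) x, ← mul_smul, ← zpow_natCast, ← zpow_add]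
    congr 3; omega
  · rw [SimpleGraph.dist_comm, ← hG.dist_smul hc (g ^ n) x, ← mul_smul, ← zpow_natCast, ← zpow_add]
    congr 3; omega

section

variable {Υ : Type w} [MetricSpace Υ] [MulAction G Υ] {f : V → Υ} {lam₁ lam₂ ε : ℝ}

/-- If the `g`-orbits in `Υ` grow at least with speed `r`, then those in the cube complex grow at least
with speed `r / lam₂`; the additive constants disappear, as one passes to powers of `g ^ n`. -/
theorem IsDeckAction.mul_le_of_growth [IsIsometricSMul G Υ] (hG : T.IsDeckAction G)
    (hc : T.graph.Connected) (hlam₂ : 0 ≤ lam₂)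
    (hf : ∀ (a : G) (x : V), f (a • x) = a • f x) (hqi : IsQuasiIsometryWith T lam₁ lam₂ ε f)
    {g : G} {r C : ℝ} {q : Υ} (hr : ∀ n : ℕ, n * r ≤ C + dist q (g ^ n • q)) (y : V) (n : ℕ) :
    n * r ≤ lam₂ * T.graph.dist y (g ^ n • y) := by
  by_contra! hlt
  set d := (n : ℝ) * r - lam₂ * T.graph.dist y (g ^ n • y) with hd
  have hd0 : 0 < d := by linarith
  obtain ⟨k, hk⟩ := exists_nat_gt ((C + 2 * dist q (f y) + ε) / d)
  rw [div_lt_iff₀ hd0] at hk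
  have h1 := hr (n * k)
  have h2 := dist_triangle4 q (f y) (g ^ (n * k) • f y) (g ^ (n * k) • q)
  rw [_root_.dist_smul, dist_comm (f y) q] at h2
  have h3 := (hqi y (g ^ (n * k) • y)).2
  rw [hf] at h3
  have h4 : (T.graph.dist y (g ^ (n * k) • y) : ℝ) ≤ k * T.graph.dist y (g ^ n • y) := by
    rw [pow_mul]
    exact_mod_cast hG.dist_pow_smul_le hc (g ^ n) y k
  have h5 := mul_le_mul_of_nonneg_left h4 hlam₂
  push_cast at h1
  have : (k : ℝ) * d = n * k * r - lam₂ * (k * T.graph.dist y (g ^ n • y)) := by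
    rw [hd]; ring
  linarith

theorem mul_stableTranslationLength_le [IsIsometricSMul G Υ] (g : G) (p : Υ) (n : ℕ) :
    n * stableTranslationLength g p ≤ dist p (g ^ n • p) := by
  rcases Nat.eq_zero_or_pos n with rfl | hn
  · simp
  have hsub : Subadditive (fun n : ℕ => dist p (g ^ n • p)) := by
    intro m n
    have := dist_triangle p (g ^ m • p) (g ^ (m + n) • p)
    rwa [pow_add, mul_smul, _root_.dist_smul, ← mul_smul, ← pow_add] at this
  have hbdd : BddBelow (Set.range fun n : ℕ => dist p (g ^ n • p) / n) :=
    ⟨0, by rintro _ ⟨n, rfl⟩; positivity⟩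
  have hlim := tendsto_nhds_unique (tendsto_stableTranslationLength g p) (hsub.tendsto_lim hbdd)
  have h := hsub.lim_le_div hbdd hn.ne'
  rw [← hlim, le_div_iff₀ (by exact_mod_cast hn)] at h
  linarith

/-- The stable translation length in `Υ` is at most `lam₂` times the systole. -/
theorem IsDeckAction.stableTranslationLength_le_systole [IsIsometricSMul G Υ]
    (hG : T.IsDeckAction G) (hc : T.graph.Connected) (hlam₂ : 0 ≤ lam₂)
    (hf : ∀ (a : G) (x : V), f (a • x) = a • f x) (hqi : IsQuasiIsometryWith T lam₁ lam₂ ε f)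
    (g : G) (p : Υ) (hg : 0 ≤ stableTranslationLength g p) {Y : Set V} (hY : Y.Nonempty) :
    stableTranslationLength g p ≤ lam₂ * T.systole g Y := by
  obtain ⟨y₀, hy₀⟩ := hY
  have hne : {ℓ : ℕ | ∃ y ∈ Y, ∃ n : ℤ, n ≠ 0 ∧ ℓ = T.graph.dist y (g ^ n • y)}.Nonempty :=
    ⟨_, y₀, hy₀, 1, one_ne_zero, rfl⟩
  obtain ⟨y, -, n, hn, hsys⟩ := Nat.sInf_mem hne
  have h1 := hG.mul_le_of_growth hc hlam₂ hf hqi (C := 0) (q := p)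
    (fun n => by rw [zero_add]; exact mul_stableTranslationLength_le g p n) y n.natAbs
  have h2 := hG.dist_zpow_smul hc g y 0 n
  rw [zpow_zero, one_smul, zero_sub, Int.natAbs_neg] at h2
  rw [systole, hsys, h2]
  refine le_trans ?_ h1
  have : (1 : ℝ) ≤ n.natAbs := by exact_mod_cast Int.natAbs_pos.2 hn
  nlinarith

end

end CubeComplex

/-! ### Axes in the hyperbolic space -/

section Axes

open CubeComplex

variable {Υ : Type w} [MetricSpace Υ] {G : Type v} [Group G] [MulAction G Υ] {δ : ℝ}

theorem IsGeodesicAxis.growth {g : G} {γ : ℝ → Υ} (hγ : Isometry γ) {τ : ℝ}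
    (h : ∀ t, g • γ t = γ (t + τ)) (n : ℕ) : n * |τ| ≤ 0 + dist (γ 0) (g ^ n • γ 0) := by
  have := zpow_smul_of_translates h n 0
  rw [zpow_natCast] at this
  rw [this, hγ.dist_eq, Real.dist_eq, zero_add, zero_add, zero_sub, abs_neg]
  simp [abs_mul]

variable [IsIsometricSMul G Υ]

theorem IsGeodesicAxis.smul {g : G} {γ : ℝ → Υ} (h : IsGeodesicAxis g γ) (a : G) :
    IsGeodesicAxis (a * g * a⁻¹) (fun t => a • γ t) := by
  obtain ⟨h1, τ, hτ, h2⟩ := h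
  refine ⟨(isometry_smul Υ a).comp h1, τ, hτ, fun t => ?_⟩
  rw [mul_smul, inv_smul_smul, mul_smul, h2]

/-- A point that is close to the segments joining `g⁻ᵏ z` and `gᵏ z` for all large `k` is close to every
axis of `g`. -/
theorem IsHyperbolicSpace.exists_dist_axis_le (hδ : IsHyperbolicSpace Υ δ) (hΥ : IsGeodesicSpace Υ)
    {g : G} {γ : ℝ → Υ} (hγ : IsGeodesicAxis g γ) {q z : Υ} {D : ℝ} {k₀ : ℕ}
    (h : ∀ k : ℕ, k₀ ≤ k → ∀ A, IsGeodesicSegment A (g ^ (-k : ℤ) • z) (g ^ (k : ℤ) • z) →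
      ∃ a ∈ A, dist q a ≤ D) : ∃ r, dist q (γ r) ≤ D + 2 * δ := by
  obtain ⟨hiso, τ, hτ, htr⟩ := hγ
  refine hδ.exists_dist_line_le hΥ hiso (B := dist z (γ 0)) fun R => ?_
  obtain ⟨k, hk⟩ := exists_nat_gt ((R + dist q (γ 0)) / |τ|)
  rw [div_lt_iff₀ (abs_pos.2 hτ)] at hk
  obtain ⟨A, hA⟩ := hΥ (g ^ (-(max k k₀ : ℕ) : ℤ) • z) (g ^ ((max k k₀ : ℕ) : ℤ) • z)
  have hfar : ∀ m : ℤ, (k : ℝ) ≤ |(m : ℝ)| → R ≤ dist q (γ (m • τ)) := by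
    intro m hm
    have h1 := dist_triangle_left (γ 0) (γ (m • τ)) q
    rw [hiso.dist_eq, Real.dist_eq, zero_sub, abs_neg, zsmul_eq_mul, abs_mul] at h1
    have : (k : ℝ) * |τ| ≤ |(m : ℝ)| * |τ| := by gcongr
    rw [zsmul_eq_mul]
    linarith
  have hclose : ∀ m : ℤ, dist (g ^ m • z) (γ (m • τ)) ≤ dist z (γ 0) := by
    intro m
    have := zpow_smul_of_translates htr m 0
    rw [zero_add] at this
    rw [← this, dist_smul]
  have hcast : ∀ n : ℕ, |((n : ℤ) : ℝ)| = n := fun n => by simp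
  refine ⟨_, _, _, _, A, hA, hclose _, hclose _, hfar _ ?_, hfar _ ?_,
    h _ (le_max_right _ _) A hA⟩
  · rw [Int.cast_neg, abs_neg, hcast]
    exact_mod_cast le_max_left _ _
  · rw [hcast]
    exact_mod_cast le_max_left _ _

/-- Elements whose axes share an endpoint at infinity have a common power. -/
theorem IsGeometricAction.exists_zpow_eq (hG : IsGeometricAction G Υ) {g g' : G} {γ γ' : ℝ → Υ}
    (hγ : IsGeodesicAxis g γ) (hγ' : IsGeodesicAxis g' γ') (hs : SharesEndpoint γ γ') :
    ∃ a b : ℤ, a ≠ 0 ∧ b ≠ 0 ∧ g ^ a = g' ^ b := by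
  obtain ⟨hiso, τ, hτ, htr⟩ := hγ
  obtain ⟨hiso', τ', hτ', htr'⟩ := hγ'
  obtain ⟨s, s', hs, hs', B, hB⟩ := hs
  have hsign : ∀ s τ : ℝ, (s = 1 ∨ s = -1) → ∃ u : ℤ, u ≠ 0 ∧ (u : ℝ) * τ = s * |τ| := by
    rintro s τ (rfl | rfl) <;> rcases abs_cases τ with ⟨h, -⟩ | ⟨h, -⟩ <;> rw [h]
    exacts [⟨1, by simp⟩, ⟨-1, by simp⟩, ⟨-1, by simp⟩, ⟨1, by simp⟩]
  obtain ⟨u, hu, huτ⟩ := hsign s τ hs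
  obtain ⟨u', -, huτ'⟩ := hsign s' τ' hs'
  have hpos : 0 < |τ| := abs_pos.2 hτ
  have hpos' : 0 < |τ'| := abs_pos.2 hτ'
  have habs' : |s'| = 1 := by rcases hs' with rfl | rfl <;> simp
  -- `g ^ (u n) γ(0)` and `g' ^ (u' m) γ'(0)` are uniformly close for suitable `m = m(n)`
  have hclose : ∀ n : ℕ, ∃ m : ℕ,
      dist (g ^ (u * n) • γ 0) (g' ^ (u' * m) • γ' 0) ≤ B + |τ'| := by
    intro n
    have hn : 0 ≤ (n : ℝ) * |τ| := by positivity
    refine ⟨⌊n * |τ| / |τ'|⌋₊, ?_⟩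
    set m := ⌊n * |τ| / |τ'|⌋₊
    have h1 : (m : ℝ) * |τ'| ≤ n * |τ| := by
      rw [← le_div_iff₀ hpos']
      exact Nat.floor_le (by positivity)
    have h2 : (n : ℝ) * |τ| < (m + 1) * |τ'| := by
      rw [← div_lt_iff₀ hpos']
      exact Nat.lt_floor_add_one _
    have h3 := hB _ hn
    rw [zpow_smul_of_translates htr, zpow_smul_of_translates htr', zero_add, zero_add,
      zsmul_eq_mul, zsmul_eq_mul]
    push_cast
    rw [mul_right_comm (u : ℝ), huτ, mul_right_comm (u' : ℝ), huτ']
    have h4 := dist_triangle (γ (s * |τ| * n)) (γ' (s' * (n * |τ|))) (γ' (s' * |τ'| * m))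
    rw [hiso'.dist_eq, Real.dist_eq, show s' * (n * |τ|) - s' * |τ'| * m =
      s' * (n * |τ| - m * |τ'|) by ring, abs_mul, habs', one_mul,
      abs_of_nonneg (a := n * |τ| - m * |τ'|) (by linarith)] at h4
    rw [show s * (n * |τ|) = s * |τ| * n by ring] at h3
    linarith
  choose m hm using hclose
  -- properness and the pigeonhole principle
  have hfin := hG.proper (γ' 0) (dist (γ 0) (γ' 0) + (B + |τ'|))
  have hmem : ∀ n : ℕ, g ^ (-(u * n)) * g' ^ (u' * m n) ∈
      {a : G | dist (γ' 0) (a • γ' 0) ≤ dist (γ 0) (γ' 0) + (B + |τ'|)} := by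
    intro n
    have h1 := hm n
    rw [← dist_smul (g ^ (-(u * n))), ← mul_smul, ← zpow_add, neg_add_cancel, zpow_zero,
      one_smul, ← mul_smul] at h1
    have h2 := dist_triangle (γ' 0) (γ 0) ((g ^ (-(u * n)) * g' ^ (u' * m n)) • γ' 0)
    rw [dist_comm (γ' 0) (γ 0)] at h2
    simp only [Set.mem_ofPred_eq]
    linarith
  obtain ⟨n, n', hne, heq⟩ : ∃ n n' : ℕ, n ≠ n' ∧
      g ^ (-(u * n)) * g' ^ (u' * m n) = g ^ (-(u * n')) * g' ^ (u' * m n') := by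
    by_contra! hcon
    exact Set.infinite_of_injective_forall_mem (fun n n' h => by_contra fun hne =>
      hcon n n' hne h) hmem hfin
  have hpow : g ^ (u * ((n' : ℤ) - n)) = g' ^ (u' * ((m n' : ℤ) - m n)) := by
    have e1 : u * ((n' : ℤ) - n) = u * n' + -(u * n) := by ring
    have e2 : u' * ((m n' : ℤ) - m n) = u' * m n' + -(u' * m n) := by ring
    rw [e1, e2, zpow_add, zpow_add, ← mul_inv_eq_one, mul_inv_rev, ← zpow_neg, ← zpow_neg,
      neg_neg, mul_assoc, ← mul_assoc (g ^ (-(u * n))), heq]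
    group
  have ha : u * ((n' : ℤ) - n) ≠ 0 := mul_ne_zero hu (by omega)
  refine ⟨_, _, ha, fun hb => ?_, hpow⟩
  rw [hb, zpow_zero] at hpow
  have h1 := zpow_smul_of_translates htr (u * ((n' : ℤ) - n)) 0
  rw [hpow, one_smul] at h1
  have h2 := hiso.injective h1
  rw [zero_add, zsmul_eq_mul, zero_eq_mul] at h2
  rcases h2 with h2 | h2
  · exact ha (by exact_mod_cast h2)
  · exact hτ h2

/-- If a subgroup that contains a non-trivial translation has a `κ`-quasiconvex orbit, then `κ` is
non-negative: otherwise a geodesic between two points of the orbit would lie in the orbit, which is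
locally finite. -/
theorem IsGeometricAction.quasiconvex_nonneg (hG : IsGeometricAction G Υ) (hΥ : IsGeodesicSpace Υ)
    {H : Subgroup G} {b : G} (hb : b ∈ H) {γ : ℝ → Υ} (hγ : IsGeodesicAxis b γ) {p : Υ} {κ : ℝ}
    (hκ : IsQuasiconvex {y : Υ | ∃ h ∈ H, y = h • p} κ) : 0 ≤ κ := by
  by_contra! hneg
  obtain ⟨hiso, τ, hτ, htr⟩ := hγ
  have hne : p ≠ b • p := by
    intro hp
    have hpow : ∀ n : ℕ, b ^ n • p = p := by
      intro n
      induction n with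
      | zero => simp
      | succ n ih => rw [pow_succ, mul_smul, ← hp, ih]
    obtain ⟨n, hn⟩ := exists_nat_gt (2 * dist (γ 0) p / |τ|)
    rw [div_lt_iff₀ (abs_pos.2 hτ)] at hn
    have h1 := IsGeodesicAxis.growth hiso htr n
    have h2 := dist_triangle (γ 0) p (b ^ n • γ 0)
    have h3 := dist_smul (b ^ n) p (γ 0)
    rw [hpow, dist_comm p (γ 0)] at h3
    linarith
  obtain ⟨A, hA⟩ := hΥ p (b • p)
  have hsub := hκ p ⟨1, H.one_mem, by simp⟩ (b • p) ⟨b, hb, rfl⟩ A hA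
  rw [Metric.cthickening_of_nonpos hneg.le] at hsub
  have hfin := (hG.proper p (dist p (b • p) + 1)).image (fun g => g • p)
  have hAfin : A ⊆ (fun g : G => g • p) '' {g | dist p (g • p) ≤ dist p (b • p) + 1} := by
    intro a ha
    have h1 : a ∈ Metric.ball p (dist p (b • p) + 1) := by
      rw [Metric.mem_ball, dist_comm]
      linarith [hA.dist_le ha]
    refine hfin.isClosed.closure_subset_iff.2 ?_ (Metric.isOpen_ball.inter_closure ⟨h1, hsub ha⟩)
    rintro _ ⟨h4, h, -, rfl⟩
    rw [Metric.mem_ball, dist_comm] at h4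
    exact ⟨h, h4.le, rfl⟩
  exact (hfin.subset hAfin).not_infinite
    (hA.isPreconnected.infinite_of_nontrivial ⟨p, hA.left_mem, b • p, hA.right_mem, hne⟩)

/-- For points `ℓ₁ 0`, `ℓ₂ 0` on two lines one can choose directions along the lines so that geodesics
between far away points in these directions pass close to `ℓ₁ 0` and `ℓ₂ 0`. -/
theorem IsHyperbolicSpace.exists_directions (hδ : IsHyperbolicSpace Υ δ) (hΥ : IsGeodesicSpace Υ)
    {ℓ₁ ℓ₂ : ℝ → Υ} (h₁ : Isometry ℓ₁) (h₂ : Isometry ℓ₂) {t : ℝ} (ht : 0 ≤ t) :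
    ∃ s₁ s₂ : ℝ, (s₁ = 1 ∨ s₁ = -1) ∧ (s₂ = 1 ∨ s₂ = -1) ∧ ∃ A,
      IsGeodesicSegment A (ℓ₁ (s₁ * t)) (ℓ₂ (s₂ * t)) ∧ (∃ a ∈ A, dist (ℓ₁ 0) a ≤ 3 * δ) ∧
        ∃ a ∈ A, dist (ℓ₂ 0) a ≤ 3 * δ := by
  have h0 := hδ.nonneg (ℓ₁ 0)
  have key : ∀ (ℓ : ℝ → Υ), Isometry ℓ → ∀ z : Υ, ∃ s : ℝ, (s = 1 ∨ s = -1) ∧ ∃ A,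
      IsGeodesicSegment A (ℓ (s * t)) z ∧ ∃ a ∈ A, dist (ℓ 0) a ≤ δ := by
    intro ℓ hℓ z
    obtain ⟨B, hB⟩ := hΥ (ℓ t) z
    obtain ⟨C, hC⟩ := hΥ z (ℓ (-t))
    obtain ⟨b, hb | hb, hab⟩ := hδ _ _ _ _ _ _ (hℓ.isGeodesicSegment (-t) t) hB hC (ℓ 0)
      ⟨0, by rw [Set.uIcc_of_le (by linarith)]; exact ⟨by linarith, ht⟩, rfl⟩
    · exact ⟨1, Or.inl rfl, B, by rwa [one_mul], b, hb, hab⟩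
    · exact ⟨-1, Or.inr rfl, C, by rw [neg_one_mul]; exact hC.symm, b, hb, hab⟩
  obtain ⟨s₁, hs₁, C, hC, b, hb, hab⟩ := key ℓ₁ h₁ (ℓ₂ 0)
  obtain ⟨s₂, hs₂, A, hA, a, ha, haa⟩ := key ℓ₂ h₂ (ℓ₁ (s₁ * t))
  refine ⟨s₁, s₂, hs₁, hs₂, A, hA.symm, ?_, a, ha, by linarith⟩
  obtain ⟨P, hP⟩ := hΥ (ℓ₂ 0) a
  obtain ⟨A', hA', hseg⟩ := hA.exists_subset ha hA.right_mem
  obtain ⟨b', hb' | hb', hbb⟩ := hδ _ _ _ _ _ _ hC hP hseg b hb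
  · refine ⟨a, ha, ?_⟩
    have h4 := hP.symm.dist_le hb'
    rw [dist_comm a b', dist_comm a] at h4
    linarith [dist_triangle4 (ℓ₁ 0) b b' a]
  · exact ⟨b', hA' hb', by linarith [dist_triangle (ℓ₁ 0) b b']⟩

end Axes

/-! ### Hulls and carriers in the hyperbolic space -/

namespace CubeComplex

variable {V : Type u} {T : CubeComplex V} {G : Type v} [Group G] [MulAction G V]

theorem dist_getVert (hc : T.graph.Connected) {x y : V} (p : T.graph.Walk x y)
    (hp : p.length = T.graph.dist x y) {i j : ℕ} (hij : i ≤ j) (hj : j ≤ p.length) :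
    T.graph.dist (p.getVert i) (p.getVert j) = j - i := by
  have hle : ∀ i j, i ≤ j → j ≤ p.length → T.graph.dist (p.getVert i) (p.getVert j) ≤ j - i := by
    intro i j hij
    induction j, hij using Nat.le_induction with
    | base => simp
    | succ j hij ih =>
      intro hj
      have h1 := ih (by omega)
      have h2 := hc.dist_triangle (u := p.getVert i) (v := p.getVert j) (w := p.getVert (j + 1))
      rw [SimpleGraph.dist_eq_one_iff_adj.2 (p.adj_getVert_succ (by omega))] at h2
      omega
  have h1 := hle 0 i (Nat.zero_le _) (hij.trans hj)
  have h2 := hle i j hij hj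
  have h3 := hle j p.length hj le_rfl
  rw [p.getVert_zero] at h1
  rw [p.getVert_length] at h3
  have h4 := hc.dist_triangle (u := x) (v := p.getVert i) (w := y)
  have h5 := hc.dist_triangle (u := p.getVert i) (v := p.getVert j) (w := y)
  omega

/-- The images of hulls of axes are uniformly close to the axes in `Υ`: a vertex of the hull lies on a
geodesic between two far away points of the axis, which is mapped to a quasi-geodesic. -/
theorem IsCAT0.exists_hull_near_axis (hT : T.IsCAT0) (δ : ℝ) {lam₁ lam₂ ε : ℝ} (hlam₁ : 0 < lam₁) (hlam₂ : 0 < lam₂) (hε : 0 < ε) :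
    ∃ D : ℝ, ∀ (Υ : Type w) [MetricSpace Υ] [MulAction G Υ] [IsIsometricSMul G Υ],
      IsGeodesicSpace Υ → IsHyperbolicSpace Υ δ →
      ∀ f : V → Υ, (∀ (a : G) (x : V), f (a • x) = a • f x) →
      IsQuasiIsometryWith T lam₁ lam₂ ε f →
      ∀ (g : G) (w : ℤ → V) (γ : ℝ → Υ), T.IsAxis g w → IsGeodesicAxis g γ →
      ∀ v ∈ T.hull (Set.range w), ∃ r, dist (f v) (γ r) ≤ D := by
  have hpos : 0 < lam₁ * ε := by positivity
  obtain ⟨D, hD⟩ := exists_quasiGeodesic_near_geodesic.{w} δ (lam₂ + ε + lam₁ + lam₁ * ε)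
    (by positivity)
  refine ⟨D + 2 * δ, fun Υ _ _ _ hΥ hδ f hf hqi g w γ hw hγ v hv => ?_⟩
  obtain ⟨hline, τ, hτ, htr⟩ := hw
  have hline : T.IsLine w := hline
  obtain ⟨n, hn⟩ := (hT.mem_hull_line_iff hline).1 hv
  refine hδ.exists_dist_axis_le hΥ hγ (z := f (w 0)) (k₀ := n) fun k hk A hA => ?_
  have hm : n ≤ k * τ.natAbs := hk.trans (Nat.le_mul_of_pos_right _ (Int.natAbs_pos.2 hτ))
  set m := k * τ.natAbs with hm_def
  have hbetween := hline.interval_mono hT.1.1 hm hn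
  obtain ⟨p₁, hp₁⟩ := hT.1.1.exists_walk_length_eq_dist (w (-m)) v
  obtain ⟨p₂, hp₂⟩ := hT.1.1.exists_walk_length_eq_dist v (w m)
  have hlen : (p₁.append p₂).length = T.graph.dist (w (-m)) (w m) := by
    rw [SimpleGraph.Walk.length_append, hp₁, hp₂, hbetween]
  set p := p₁.append p₂ with hp
  have hqg : IsQuasiGeodesic (lam₂ + ε + lam₁ + lam₁ * ε) p.length (fun i => f (p.getVert i)) := by
    constructor
    · intro i hi
      have h1 := (hqi (p.getVert i) (p.getVert (i + 1))).2
      rw [SimpleGraph.dist_eq_one_iff_adj.2 (p.adj_getVert_succ hi)] at h1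
      push_cast at h1
      linarith
    · intro i hi j hj
      wlog hij : i ≤ j generalizing i j
      · rw [abs_sub_comm, dist_comm]
        exact this j hj i hi (by omega)
      have h1 := (hqi (p.getVert i) (p.getVert j)).1
      rw [dist_getVert hT.1.1 p hlen hij hj, Nat.cast_sub hij, one_div, sub_le_iff_le_add,
        inv_mul_le_iff₀ hlam₁] at h1
      have h2 : (i : ℝ) ≤ j := by exact_mod_cast hij
      rw [abs_sub_comm, abs_of_nonneg (by linarith)]
      have h3 := dist_nonneg (x := f (p.getVert i)) (y := f (p.getVert j))
      nlinarith
  have hend : IsGeodesicSegment A (f (w (-m))) (f (w m)) ∨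
      IsGeodesicSegment A (f (w m)) (f (w (-m))) := by
    rw [← hf, ← hf, zpow_smul_of_translates htr, zpow_smul_of_translates htr, zero_add, zero_add,
      smul_eq_mul, smul_eq_mul, neg_mul] at hA
    have hcast : (m : ℤ) = k * |τ| := by rw [hm_def]; push_cast; rfl
    rcases abs_cases τ with ⟨h, -⟩ | ⟨h, -⟩
    · left
      rwa [hcast, h]
    · right
      rwa [hcast, h, mul_neg, neg_neg]
  have hend : IsGeodesicSegment A (f (p.getVert 0)) (f (p.getVert p.length)) := by
    rw [p.getVert_zero, p.getVert_length]
    exact hend.elim id fun h => h.symm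
  obtain ⟨a, ha, hda⟩ := hD Υ hΥ hδ _ _ hqg A hend p₁.length
    (by rw [hp, SimpleGraph.Walk.length_append]; omega)
  refine ⟨a, ha, ?_⟩
  have hv : p.getVert p₁.length = v := by
    rw [hp, SimpleGraph.Walk.getVert_append]; simp
  rwa [hv] at hda

/-- The carrier of a hyperplane is bounded, or its image in `Υ` lies, with a constant that is independent
of the basepoint `p`, in a neighbourhood of the union of the geodesics between points of the orbit of
`p` under the stabilizer.  In the second case the stabilizer contains an infinite cyclic group, and
one extends a geodesic between two points of the image of the carrier along axes of conjugates of its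
generator, to arbitrarily long geodesics; replacing far away endpoints by points of the orbit of `p`
affects the geodesic only near its ends. -/
theorem IsCAT0.exists_carrier_near (hT : T.IsCAT0) (hG : T.IsDeckAction G) {U : Set (Sym2 V)}
    (hU : T.IsHyperplane U) (δ : ℝ) {lam₁ lam₂ ε : ℝ} (hlam₁ : 0 < lam₁) (hlam₂ : 0 < lam₂)
    (hε : 0 < ε) :
    ∃ E : ℝ, ∀ (Υ : Type w) [MetricSpace Υ] [MulAction G Υ] [IsIsometricSMul G Υ],
      IsGeodesicSpace Υ → IsHyperbolicSpace Υ δ → IsGeometricAction G Υ →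
      (∀ a : G, a ≠ 1 → ∃ γ : ℝ → Υ, IsGeodesicAxis a γ) →
      ∀ f : V → Υ, (∀ (a : G) (x : V), f (a • x) = a • f x) →
      IsQuasiIsometryWith T lam₁ lam₂ ε f → ∀ (p : Υ) (κ : ℝ),
      IsQuasiconvex {y : Υ | ∃ h ∈ hyperplaneStabilizer G U, y = h • p} κ →
      (∀ x ∈ carrier U, ∀ y ∈ carrier U, (T.graph.dist x y : ℝ) ≤ E) ∨
      (0 ≤ κ ∧ ∀ x ∈ carrier U, ∀ y ∈ carrier U, ∃ h₁ ∈ hyperplaneStabilizer G U,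
        ∃ h₂ ∈ hyperplaneStabilizer G U, ∃ S, IsGeodesicSegment S (h₁ • p) (h₂ • p) ∧
          (∃ a ∈ S, dist (f x) a ≤ E) ∧ ∃ a ∈ S, dist (f y) a ≤ E) := by
  obtain ⟨F, hF, hcov⟩ := hG.exists_finite_carrier hU
  obtain ⟨x₀, -⟩ := hU.carrier_nonempty
  obtain ⟨R, hR⟩ := (hF.image fun x => T.graph.dist x₀ x).bddAbove
  replace hR : ∀ x ∈ F, T.graph.dist x₀ x ≤ R := fun x hx => hR ⟨x, hx, rfl⟩
  by_cases hbot : ∃ b ∈ hyperplaneStabilizer G U, b ≠ 1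
  swap
  · push Not at hbot
    refine ⟨2 * R, fun Υ _ _ _ _ _ _ _ f _ _ p κ _ => Or.inl fun x hx y hy => ?_⟩
    have hcar : ∀ x ∈ carrier U, T.graph.dist x₀ x ≤ R := by
      intro x hx
      obtain ⟨h, hh, x', hx', rfl⟩ := hcov x hx
      rw [hbot h hh, one_smul]
      exact hR x' hx'
    have h1 := hT.1.1.dist_triangle (u := x) (v := x₀) (w := y)
    have h2 := hcar x hx
    have h3 := hcar y hy
    rw [SimpleGraph.dist_comm] at h2
    have : T.graph.dist x y ≤ 2 * R := by
      rw [SimpleGraph.dist_comm] at h2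
      rw [SimpleGraph.dist_comm (u := x) (v := x₀)] at h1
      omega
    exact_mod_cast this
  obtain ⟨b, hb, hb1⟩ := hbot
  -- the growth rate `c` of the orbit of `x₀` in the cube complex depends on `T` only
  by_cases hgrow : ∃ c : ℝ, 0 < c ∧ ∀ n : ℕ, n * c ≤ T.graph.dist x₀ (b ^ n • x₀)
  swap
  · refine ⟨0, fun Υ _ _ _ hΥ hδ hgeo hax f hf hqi p κ hκ => absurd ?_ hgrow⟩
    obtain ⟨γ, hiso, τ, hτ, htr⟩ := hax b hb1
    refine ⟨|τ| / lam₂, by positivity, fun n => ?_⟩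
    rw [← mul_div_assoc, div_le_iff₀' hlam₂]
    exact hG.mul_le_of_growth hT.1.1 hlam₂.le hf hqi (IsGeodesicAxis.growth hiso htr) x₀ n
  obtain ⟨c, hc, hgrow⟩ := hgrow
  have hK0 : 0 < lam₁ / c * ε := by positivity
  have hK1 : 0 < lam₁ / c := by positivity
  have hK2 : 0 ≤ lam₂ * T.graph.dist x₀ (b • x₀) := by positivity
  set K := lam₂ * T.graph.dist x₀ (b • x₀) + ε + lam₁ / c + lam₁ / c * ε with hK
  obtain ⟨D, hD⟩ := exists_quasiGeodesic_near_geodesic.{w} δ K (by positivity)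
  refine ⟨lam₂ * R + ε + (D + 2 * δ) + 3 * δ + 2 * δ,
    fun Υ _ _ _ hΥ hδ hgeo hax f hf hqi p κ hκ => Or.inr ?_⟩
  obtain ⟨γ, hγ⟩ := hax b hb1
  refine ⟨hgeo.quasiconvex_nonneg hΥ hb hγ hκ, ?_⟩
  have hδ0 := hδ.nonneg p
  obtain ⟨r, hr⟩ : ∃ r, dist (f x₀) (γ r) ≤ D + 2 * δ := by
    refine hδ.exists_dist_axis_le hΥ hγ (z := f x₀) (k₀ := 0) fun k _ A hA => ?_
    have hqg : IsQuasiGeodesic K (2 * k) (fun i => f (b ^ ((i : ℤ) - k) • x₀)) := by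
      constructor
      · intro i hi
        have h1 := (hqi (b ^ ((i : ℤ) - k) • x₀) (b ^ (((i + 1 : ℕ) : ℤ) - k) • x₀)).2
        rw [hG.dist_zpow_smul hT.1.1,
          show ((i : ℤ) - k - (((i + 1 : ℕ) : ℤ) - k)).natAbs = 1 by omega, pow_one] at h1
        exact h1.trans (by linarith)
      · intro i hi j hj
        have h1 := (hqi (b ^ ((i : ℤ) - k) • x₀) (b ^ ((j : ℤ) - k) • x₀)).1
        have h2 := hgrow ((i : ℤ) - k - (j - k)).natAbs
        rw [hG.dist_zpow_smul hT.1.1, one_div, sub_le_iff_le_add, inv_mul_le_iff₀ hlam₁] at h1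
        have h3 : ((((i : ℤ) - k - (j - k)).natAbs : ℕ) : ℝ) = |(i : ℝ) - j| := by
          rw [Nat.cast_natAbs]; push_cast; congr 1; ring
        rw [h3] at h2
        set d := dist (f (b ^ ((i : ℤ) - k) • x₀)) (f (b ^ ((j : ℤ) - k) • x₀)) with hd
        have hd0 : 0 ≤ d := dist_nonneg
        have h4 : |(i : ℝ) - j| ≤ lam₁ / c * d + lam₁ / c * ε := by
          rw [← mul_add, div_mul_eq_mul_div, le_div_iff₀ hc]
          linarith
        have h5 : lam₁ / c * d ≤ K * d := by
          gcongr
          linarith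
        exact h4.trans (by linarith)
    obtain ⟨a, ha, hda⟩ := hD Υ hΥ hδ (2 * k) _ hqg A (by
      rw [← hf, ← hf] at hA
      convert hA using 4 <;> push_cast <;> ring) k (by omega)
    refine ⟨a, ha, ?_⟩
    simpa using hda
  intro x hx y hy
  obtain ⟨h₁, hh₁, x', hx', rfl⟩ := hcov x hx
  obtain ⟨h₂, hh₂, y', hy', rfl⟩ := hcov y hy
  obtain ⟨hiso, τ, hτ, htr⟩ := hγ
  -- the lines through the points `hᵢ γ(r)`, which are close to `f x` and `f y`
  have hline : ∀ h : G, Isometry fun t => h • γ (r + t) := fun h =>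
    (isometry_smul Υ h).comp (hiso.comp (isometry_add_left r))
  have hnear : ∀ (h : G), ∀ x' ∈ F, dist (f (h • x')) (h • γ (r + 0)) ≤
      lam₂ * R + ε + (D + 2 * δ) := by
    intro h x' hx'
    rw [hf, _root_.dist_smul, add_zero]
    have h1 := (hqi x₀ x').2
    have h2 : lam₂ * (T.graph.dist x₀ x' : ℝ) ≤ lam₂ * R := by
      have := hR x' hx'
      gcongr
    linarith [dist_triangle_left (f x') (γ r) (f x₀)]
  set Δ := dist (h₁ • γ (r + 0)) (h₂ • γ (r + 0)) with hΔ
  have hΔ0 : 0 ≤ Δ := dist_nonneg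
  set B := dist (γ r) p with hB
  obtain ⟨n, hn⟩ := exists_nat_gt ((B + 2 * δ + 3 * δ + Δ) / |τ|)
  rw [div_lt_iff₀ (abs_pos.2 hτ)] at hn
  set t := (n : ℝ) * |τ| with ht
  have ht0 : 0 ≤ t := by positivity
  obtain ⟨s₁, s₂, hs₁, hs₂, A, hA, ⟨a₁, ha₁, hd₁⟩, a₂, ha₂, hd₂⟩ :=
    hδ.exists_directions hΥ (hline h₁) (hline h₂) ht0
  have horbit : ∀ (h : G) (s : ℝ), h ∈ hyperplaneStabilizer G U → (s = 1 ∨ s = -1) →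
      ∃ h' ∈ hyperplaneStabilizer G U, dist (h • γ (r + s * t)) (h' • p) = B := by
    intro h s hh hs
    obtain ⟨j, hj⟩ : ∃ j : ℤ, (j : ℝ) * τ = s * t := by
      rcases hs with rfl | rfl <;> rcases abs_cases τ with ⟨h, -⟩ | ⟨h, -⟩ <;> rw [ht, h]
      exacts [⟨n, by simp⟩, ⟨-n, by simp⟩, ⟨-n, by simp⟩, ⟨n, by simp⟩]
    refine ⟨h * b ^ j, mul_mem hh (zpow_mem hb j), ?_⟩
    rw [← hj, ← zsmul_eq_mul, ← zpow_smul_of_translates htr, mul_smul, _root_.dist_smul,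
      _root_.dist_smul]
  obtain ⟨k₁, hk₁, hB₁⟩ := horbit h₁ s₁ hh₁ hs₁
  obtain ⟨k₂, hk₂, hB₂⟩ := horbit h₂ s₂ hh₂ hs₂
  obtain ⟨S, hS⟩ := hΥ (k₁ • p) (k₂ • p)
  have hlen : ∀ (h : G) (s : ℝ), (s = 1 ∨ s = -1) →
      dist (h • γ (r + 0)) (h • γ (r + s * t)) = t := by
    intro h s hs
    rw [_root_.dist_smul, hiso.dist_eq, Real.dist_eq]
    rcases hs with rfl | rfl <;> simp [abs_of_nonneg ht0]
  have hl₁ := hlen h₁ s₁ hs₁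
  have hl₂ := hlen h₂ s₂ hs₂
  have hfar : ∀ (o a : Υ), dist o (h₁ • γ (r + 0)) ≤ Δ → dist o (h₂ • γ (r + 0)) ≤ Δ →
      dist o a ≤ 3 * δ → a ∈ A → ∃ b ∈ S, dist a b ≤ 2 * δ := by
    intro o a ho₁ ho₂ hoa ha
    refine hδ.exists_dist_le hΥ hA hS hB₁.le hB₂.le ha ?_ ?_
    · have h5 := dist_triangle4 (h₁ • γ (r + 0)) o a (h₁ • γ (r + s₁ * t))
      rw [dist_comm _ o] at h5
      linarith
    · have h5 := dist_triangle4 (h₂ • γ (r + 0)) o a (h₂ • γ (r + s₂ * t))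
      rw [dist_comm _ o] at h5
      linarith
  refine ⟨k₁, hk₁, k₂, hk₂, S, hS, ?_, ?_⟩
  · obtain ⟨b₁, hb₁, hab⟩ := hfar (h₁ • γ (r + 0)) a₁ (by simpa using hΔ0) le_rfl hd₁ ha₁
    refine ⟨b₁, hb₁, ?_⟩
    have h5 := dist_triangle4 (f (h₁ • x')) (h₁ • γ (r + 0)) a₁ b₁
    linarith [hnear h₁ x' hx']
  · obtain ⟨b₂, hb₂, hab⟩ := hfar (h₂ • γ (r + 0)) a₂ (by rw [dist_comm]) (by simpa using hΔ0)
      hd₂ ha₂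
    refine ⟨b₂, hb₂, ?_⟩
    have h5 := dist_triangle4 (f (h₂ • y')) (h₂ • γ (r + 0)) a₂ b₂
    linarith [hnear h₂ y' hy']

end CubeComplex

/-! ### Pieces of the cubical presentation -/

namespace CubeComplex

variable {V : Type u} {T : CubeComplex V} {G : Type v} [Group G] [MulAction G V]

theorem IsDeckAction.smul_hull_range (hG : T.IsDeckAction G) (hc : T.graph.Connected) (h : G)
    (w : ℤ → V) : h • T.hull (Set.range w) = T.hull (Set.range fun n => h • w n) := by
  rw [hG.smul_hull hc, ← Set.image_smul, ← Set.range_comp]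
  rfl

theorem IsAxis.smul (hG : T.IsDeckAction G) (hc : T.graph.Connected) {g : G} {w : ℤ → V}
    (hw : T.IsAxis g w) (h : G) : T.IsAxis (h * g * h⁻¹) (fun n => h • w n) := by
  obtain ⟨h1, τ, hτ, h2⟩ := hw
  refine ⟨IsLine.smul hG hc h h1, τ, hτ, fun n => ?_⟩
  rw [mul_smul, inv_smul_smul, mul_smul, h2]

section

variable {Υ : Type w} [MetricSpace Υ] [MulAction G Υ] [IsIsometricSMul G Υ]
  {δ lam₁ lam₂ ε : ℝ}

/-- If two translates of hulls meet but differ, then the corresponding axes share no endpoint at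
infinity. -/
theorem IsCAT0.not_sharesEndpoint (hT : T.IsCAT0) (hG : T.IsDeckAction G)
    (hgeo : IsGeometricAction G Υ) {g g' : G} {w w' : ℤ → V} {γ γ' : ℝ → Υ}
    (hw : T.IsAxis g w) (hw' : T.IsAxis g' w') (hγ : IsGeodesicAxis g γ)
    (hγ' : IsGeodesicAxis g' γ')
    (hmeet : (T.hull (Set.range w) ∩ T.hull (Set.range w')).Nonempty)
    (hne : T.hull (Set.range w) ≠ T.hull (Set.range w')) : ¬ SharesEndpoint γ γ' := by
  intro hs
  obtain ⟨a, b, ha, hb, hab⟩ := hgeo.exists_zpow_eq hγ hγ' hs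
  obtain ⟨hline, τ, hτ, htr⟩ := hw
  obtain ⟨hline', τ', hτ', htr'⟩ := hw'
  exact hne (hT.hull_eq_of_translates hG hline hline' (c := g ^ a) (τ₁ := a • τ) (τ₂ := b • τ')
    (by simp [ha, hτ]) (by simp [hb, hτ']) (zpow_smul_of_translates htr a)
    (by rw [hab]; exact zpow_smul_of_translates htr' b) hmeet)

theorem dist_le_of_quasiIsometry {f : V → Υ} (hlam₁ : 0 < lam₁)
    (hqi : IsQuasiIsometryWith T lam₁ lam₂ ε f) {x y : V} {L : ℝ} (h : dist (f x) (f y) ≤ L) :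
    (T.graph.dist x y : ℝ) ≤ lam₁ * (L + ε) := by
  have h1 := (hqi x y).1
  rw [one_div, sub_le_iff_le_add, inv_mul_le_iff₀ hlam₁] at h1
  exact h1.trans (by gcongr)

/-- Bound for the intersection of two sets whose images are `D`-close to two lines, from a bound `L` for
the overlap of these lines. -/
theorem dist_le_of_near_lines (hΥ : IsGeodesicSpace Υ) (hδ : IsHyperbolicSpace Υ δ) {f : V → Υ}
    (hlam₁ : 0 < lam₁) (hqi : IsQuasiIsometryWith T lam₁ lam₂ ε f) {γ γ' : ℝ → Υ}
    (hγ : Isometry γ) (hγ' : Isometry γ') {D L : ℝ} (hL : 0 ≤ L)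
    (hbound : ∀ s t : ℝ, γ s ∈ Metric.cthickening (2 * δ) (Set.range γ') →
      γ t ∈ Metric.cthickening (2 * δ) (Set.range γ') → |s - t| ≤ L) {x y : V}
    (hx : ∃ r, dist (f x) (γ r) ≤ D) (hy : ∃ r, dist (f y) (γ r) ≤ D)
    (hx' : ∃ r, dist (f x) (γ' r) ≤ D) (hy' : ∃ r, dist (f y) (γ' r) ≤ D) :
    (T.graph.dist x y : ℝ) ≤ lam₁ * (L + 6 * D + 4 * δ + 2 + ε) := by
  obtain ⟨s, hs⟩ := hx
  obtain ⟨t, ht⟩ := hy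
  obtain ⟨s', hs'⟩ := hx'
  obtain ⟨t', ht'⟩ := hy'
  have hmem : ∀ r, (∃ b ∈ γ' '' Set.uIcc s' t', dist (γ r) b ≤ 2 * δ) →
      γ r ∈ Metric.cthickening (2 * δ) (Set.range γ') := by
    rintro r ⟨_, ⟨r', -, rfl⟩, h⟩
    exact Metric.mem_cthickening_of_dist_le _ _ _ _ ⟨r', rfl⟩ h
  have h1 := hδ.overlap_le hΥ hγ (hγ'.isGeodesicSegment s' t') hL (E := 2 * D) (s := s) (t := t)
    (fun r r' hr hr' => hbound r r' (hmem r hr) (hmem r' hr')) ⟨s', Set.left_mem_uIcc, rfl⟩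
    ⟨t', Set.right_mem_uIcc, rfl⟩ (by linarith [dist_triangle_left (γ s) (γ' s') (f x)])
    (by linarith [dist_triangle_left (γ t) (γ' t') (f y)])
  refine dist_le_of_quasiIsometry hlam₁ hqi ?_
  have h2 := dist_triangle4 (f x) (γ s) (γ t) (f y)
  rw [hγ.dist_eq, Real.dist_eq, dist_comm (γ t)] at h2
  linarith

/-- Bound for the intersection of a set whose image is `D`-close to a line `γ` with the carrier of the
hyperplane `a U`, from a bound `L` for the overlap of `γ` with a neighbourhood of the orbit of the
basepoint under the coset of the stabilizer of `U`. -/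
theorem dist_le_of_mem_carrier (hΥ : IsGeodesicSpace Υ) (hδ : IsHyperbolicSpace Υ δ) {f : V → Υ}
    (hG : T.IsDeckAction G) (hc : T.graph.Connected)
    (hlam₁ : 0 < lam₁) (hε : 0 < ε) (hf : ∀ (a : G) (x : V), f (a • x) = a • f x)
    (hqi : IsQuasiIsometryWith T lam₁ lam₂ ε f) {p : Υ} {U : Set (Sym2 V)} {E κ' κ : ℝ}
    (hquasi : IsQuasiconvex {y : Υ | ∃ h ∈ hyperplaneStabilizer G U, y = h • p} κ')
    (hU : (∀ x ∈ carrier U, ∀ y ∈ carrier U, (T.graph.dist x y : ℝ) ≤ E) ∨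
      (0 ≤ κ' ∧ ∀ x ∈ carrier U, ∀ y ∈ carrier U, ∃ h₁ ∈ hyperplaneStabilizer G U,
        ∃ h₂ ∈ hyperplaneStabilizer G U, ∃ S, IsGeodesicSegment S (h₁ • p) (h₂ • p) ∧
          (∃ a ∈ S, dist (f x) a ≤ E) ∧ ∃ a ∈ S, dist (f y) a ≤ E))
    (hκ : κ' + 2 * δ ≤ κ) {γ : ℝ → Υ} (hγ : Isometry γ) {D L : ℝ} (hL : 0 ≤ L) (hE : 0 ≤ E) (a : G)
    (hbound : ∀ s t : ℝ,
      γ s ∈ Metric.cthickening κ {y | ∃ h ∈ hyperplaneStabilizer G U, y = (a * h) • p} →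
      γ t ∈ Metric.cthickening κ {y | ∃ h ∈ hyperplaneStabilizer G U, y = (a * h) • p} →
      |s - t| ≤ L) {x y : V}
    (hx : ∃ r, dist (f x) (γ r) ≤ D) (hy : ∃ r, dist (f y) (γ r) ≤ D)
    (hx' : x ∈ carrier (translate a U)) (hy' : y ∈ carrier (translate a U)) :
    (T.graph.dist x y : ℝ) ≤ lam₁ * (L + 4 * D + 2 * E + 4 * δ + 2 + ε) + E := by
  obtain ⟨s, hs⟩ := hx
  obtain ⟨t, ht⟩ := hy
  have hD : 0 ≤ D := dist_nonneg.trans hs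
  have hδ0 := hδ.nonneg p
  obtain ⟨x', hxU, rfl⟩ := mem_carrier_translate hx'
  obtain ⟨y', hyU, rfl⟩ := mem_carrier_translate hy'
  rcases hU with hU | ⟨hκ', hU⟩
  · rw [hG.dist_smul hc]
    have h1 := hU x' hxU y' hyU
    have h2 : 0 ≤ lam₁ * (L + 4 * D + 2 * E + 4 * δ + 2 + ε) := by positivity
    linarith
  obtain ⟨h₁, hh₁, h₂, hh₂, S, hS, ⟨u, hu, hxu⟩, v, hv, hyv⟩ := hU x' hxU y' hyU
  have hmem : ∀ r, (∃ b ∈ a • S, dist (γ r) b ≤ 2 * δ) →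
      γ r ∈ Metric.cthickening κ {y | ∃ h ∈ hyperplaneStabilizer G U, y = (a * h) • p} := by
    rintro r ⟨_, ⟨b, hb, rfl⟩, hrb⟩
    have h3 := hquasi _ ⟨h₁, hh₁, rfl⟩ _ ⟨h₂, hh₂, rfl⟩ S hS hb
    have heq : {y : Υ | ∃ h ∈ hyperplaneStabilizer G U, y = (a * h) • p} =
        a • {y : Υ | ∃ h ∈ hyperplaneStabilizer G U, y = h • p} := by
      ext z
      constructor
      · rintro ⟨h, hh, rfl⟩
        exact ⟨h • p, ⟨h, hh, rfl⟩, (mul_smul _ _ _).symm⟩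
      · rintro ⟨_, ⟨h, hh, rfl⟩, rfl⟩
        exact ⟨h, hh, (mul_smul _ _ _).symm⟩
    rw [Metric.mem_cthickening_iff] at h3 ⊢
    rw [heq]
    calc Metric.infEDist (γ r) _ ≤ Metric.infEDist (a • b)
          (a • {y : Υ | ∃ h ∈ hyperplaneStabilizer G U, y = h • p}) + edist (γ r) (a • b) :=
          Metric.infEDist_le_infEDist_add_edist
      _ ≤ ENNReal.ofReal κ' + ENNReal.ofReal (2 * δ) := by
          gcongr
          · rwa [Metric.infEDist_smul]
          · rw [edist_dist]
            exact ENNReal.ofReal_le_ofReal hrb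
      _ = ENNReal.ofReal (κ' + 2 * δ) := (ENNReal.ofReal_add hκ' (by linarith)).symm
      _ ≤ ENNReal.ofReal κ := ENNReal.ofReal_le_ofReal hκ
  rw [hf] at hs ht
  have hclose : ∀ {q u : Υ} {s : ℝ}, dist (a • q) (γ s) ≤ D → dist q u ≤ E →
      dist (γ s) (a • u) ≤ D + E := by
    intro q u s h1 h2
    rw [← _root_.dist_smul a] at h2
    linarith [dist_triangle_left (γ s) (a • u) (a • q)]
  have h1 := hδ.overlap_le hΥ hγ (hS.smul a) hL (E := D + E) (s := s) (t := t)
    (fun r r' hr hr' => hbound r r' (hmem r hr) (hmem r' hr')) (Set.smul_mem_smul_set hu)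
    (Set.smul_mem_smul_set hv) (hclose hs hxu) (hclose ht hyv)
  have h2 := dist_triangle4 (f (a • x')) (γ s) (γ t) (f (a • y'))
  rw [hγ.dist_eq, Real.dist_eq, dist_comm (γ t), hf, hf] at h2
  have h3 := dist_le_of_quasiIsometry hlam₁ hqi (x := a • x') (y := a • y')
    (L := L + 4 * D + 2 * E + 4 * δ + 2) (by rw [hf, hf]; linarith)
  linarith

end

end CubeComplex

theorem proposition5p5
    -- the universal cover `T` of the compact non-positively curved cube complex `X`, and `G = π₁ X`
    {V : Type u} (T : CubeComplex V) (hT : T.IsCAT0)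
    {G : Type v} [Group G] [MulAction G V] (hG : T.IsDeckAction G)
    (hess : ∀ U, T.IsHyperplane U → T.Essential U)
    -- `W 1, …, W m` represent the immersed hyperplanes of `X`, with fundamental groups `H 1, …, H m`
    {m : ℕ} (W : Fin m → Set (Sym2 V)) (hW : ∀ j, T.IsHyperplane (W j))
    (hW' : ∀ U, T.IsHyperplane U → ∃! j, ∃ a : G, CubeComplex.translate a (W j) = U)
    (H : Fin m → Subgroup G) (hH : ∀ j, H j = CubeComplex.hyperplaneStabilizer G (W j))
    -- the constants
    (α δ κ lam lam₁ lam₂ ε lamBar : ℝ) (hα : 0 < α)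
    (hlam₁ : 0 < lam₁) (hlam₂ : 0 < lam₂) (hε : 0 < ε) (hlam : lam₁ * lam₂ = lam)
    (hlamBar : lam < lamBar) :
    ∃ M : ℝ,
      -- the `δ`-hyperbolic space with its geometric action, and the `λ`-quasi-isometry
      ∀ (Υ : Type w) [MetricSpace Υ] [MulAction G Υ] [IsIsometricSMul G Υ],
      IsGeodesicSpace Υ → IsHyperbolicSpace Υ δ → IsGeometricAction G Υ →
      (∀ a : G, a ≠ 1 → ∃ γ : ℝ → Υ, IsGeodesicAxis a γ) →
      ∀ f : V → Υ, (∀ (a : G) (x : V), f (a • x) = a • f x) →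
      IsQuasiIsometryWith T lam₁ lam₂ ε f →
      -- the basepoint, and the quasiconvexity constants of the orbits `H j • p`
      ∀ (p : Υ) (κ' : Fin m → ℝ),
      (∀ j, IsQuasiconvex {y : Υ | ∃ h ∈ H j, y = h • p} (κ' j)) →
      κ = (⨆ j, κ' j) + 2 * δ →
      -- the relators, their axes in `Υ` and in the universal cover of `X`
      ∀ (k : ℕ) (g : Fin k → G) (γ : Fin k → ℝ → Υ) (w : Fin k → ℤ → V),
      (∀ i, IsGeodesicAxis (g i) (γ i)) → (∀ i, T.IsAxis (g i) (w i)) →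
      CubeFreeSmallCancellation H g p γ δ κ (α / lamBar) →
      (∀ i, M ≤ stableTranslationLength (g i) p) →
      T.SmallCancellation g (fun i => T.hull (Set.range (w i))) α ∧
        -- carriers of the hyperplanes of `Y i`, measured in the universal cover
        ∀ i U, T.IsHyperplane U → CubeComplex.Meets U (T.hull (Set.range (w i))) →
          T.DiamLT (T.hull (Set.range (w i)) ∩ CubeComplex.carrier U)
            (α * T.systole (g i) (T.hull (Set.range (w i)))) := by
  obtain rfl : H = fun j => CubeComplex.hyperplaneStabilizer G (W j) := funext hH
  subst hlam
  have hc := hT.1.1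
  have hlamBar0 : 0 < lamBar := (mul_pos hlam₁ hlam₂).trans hlamBar
  obtain ⟨D, hD⟩ := hT.exists_hull_near_axis.{u, v, w} (G := G) δ hlam₁ hlam₂ hε
  choose E' hE' using fun j => hT.exists_carrier_near.{u, v, w} hG (hW j) δ hlam₁ hlam₂ hε
  obtain ⟨E, hE0, hEE'⟩ : ∃ E : ℝ, 0 ≤ E ∧ ∀ j, E' j ≤ E :=
    ⟨∑ j, |E' j|, by positivity, fun j => (le_abs_self _).trans
      (Finset.single_le_sum (f := fun j => |E' j|) (fun _ _ => abs_nonneg _) (Finset.mem_univ j))⟩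
  -- pieces have diameter at most `lam₁ * (α / lamBar) * ‖g i‖ + Q`, and `α * systole` is at least
  -- `α / lam₂ * ‖g i‖`
  set Q := lam₁ * (6 * D + 2 * E + 4 * δ + 2 + ε) + E with hQ
  set θ := α / lam₂ - lam₁ * (α / lamBar) with hθ
  have hθ0 : 0 < θ := by
    rw [hθ, sub_pos, ← mul_div_assoc, div_lt_div_iff₀ hlamBar0 hlam₂]
    nlinarith
  refine ⟨|Q| / θ + 1, fun Υ _ _ _ hΥ hδ hgeo hax f hf hqi p κ' hκ' hκ k g γ w hγ hw hsc hM => ?_⟩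
  have hδ0 := hδ.nonneg p
  have hQ0 : 0 ≤ |Q| / θ := by positivity
  have hstl : ∀ i, 0 < stableTranslationLength (g i) p := fun i => by linarith [hM i]
  have hL0 : ∀ i, 0 ≤ α / lamBar * stableTranslationLength (g i) p := fun i => by
    have := hstl i; positivity
  have hmemY : ∀ i, w i 0 ∈ T.hull (Set.range (w i)) := fun i =>
    CubeComplex.subset_hull _ ⟨0, rfl⟩
  have hdiam : ∀ i (P : Set V), (∀ x ∈ P, ∀ y ∈ P, (T.graph.dist x y : ℝ) ≤
      lam₁ * (α / lamBar * stableTranslationLength (g i) p) + Q) →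
      T.DiamLT P (α * T.systole (g i) (T.hull (Set.range (w i)))) := by
    intro i P hP
    refine ⟨_, ?_, hP⟩
    have h1 := hG.stableTranslationLength_le_systole hc hlam₂.le hf hqi (g i) p (hstl i).le
      ⟨_, hmemY i⟩
    have h2 : |Q| < stableTranslationLength (g i) p * θ := by
      rw [← div_lt_iff₀ hθ0]
      linarith [hM i]
    have h3 : α / lam₂ * stableTranslationLength (g i) p ≤
        α * T.systole (g i) (T.hull (Set.range (w i))) := by
      rw [div_mul_eq_mul_div, div_le_iff₀ hlam₂]
      have := mul_le_mul_of_nonneg_left h1 hα.le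
      linarith
    have h4 := le_abs_self Q
    have h5 : stableTranslationLength (g i) p * θ = α / lam₂ * stableTranslationLength (g i) p -
        lam₁ * (α / lamBar * stableTranslationLength (g i) p) := by rw [hθ]; ring
    linarith
  have hDnear := hD Υ hΥ hδ f hf hqi
  have hcone : ∀ i j P, T.IsConePiece G (T.hull (Set.range (w i))) (T.hull (Set.range (w j))) P →
      T.DiamLT P (α * T.systole (g i) (T.hull (Set.range (w i)))) := by
    rintro i j P ⟨h, h', hne, hcomp⟩
    rw [hG.smul_hull_range hc, hG.smul_hull_range hc] at hne hcomp
    obtain ⟨⟨x₀, hx₀⟩, rfl⟩ := hcomp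
    have hwi := (hw i).smul hG hc h
    have hwj := (hw j).smul hG hc h'
    have hγi := (hγ i).smul h
    have hγj := (hγ j).smul h'
    have hshare := hT.not_sharesEndpoint hG hgeo hwi hwj hγi hγj ⟨x₀, hx₀⟩ hne
    refine hdiam i _ ?_
    rintro x ⟨hx, -⟩ y ⟨hy, -⟩
    have h1 := CubeComplex.dist_le_of_near_lines hΥ hδ hlam₁ hqi hγi.1 hγj.1 (hL0 i)
      (fun s t hs ht => (hsc.conePiece i j h h' hshare s t hs ht).le)
      (hDnear _ _ _ hwi hγi x hx.1) (hDnear _ _ _ hwi hγi y hy.1)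
      (hDnear _ _ _ hwj hγj x hx.2) (hDnear _ _ _ hwj hγj y hy.2)
    refine h1.trans ?_
    have h2 : 0 ≤ lam₁ * (2 * E) := by positivity
    rw [hQ]
    linarith
  have hwall : ∀ i U, T.IsHyperplane U →
      T.DiamLT (T.hull (Set.range (w i)) ∩ CubeComplex.carrier U)
        (α * T.systole (g i) (T.hull (Set.range (w i)))) := by
    intro i U hU
    obtain ⟨j, ⟨a, rfl⟩, -⟩ := hW' U hU
    refine hdiam i _ fun x hx y hy => ?_
    have hxD := hDnear _ _ _ (hw i) (hγ i) x hx.1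
    have hyD := hDnear _ _ _ (hw i) (hγ i) y hy.1
    have hD0 : 0 ≤ D := by
      obtain ⟨r, hr⟩ := hxD
      exact dist_nonneg.trans hr
    have hcar := hE' j Υ hΥ hδ hgeo hax f hf hqi p (κ' j) (hκ' j)
    have hle := hEE' j
    have h1 := CubeComplex.dist_le_of_mem_carrier hΥ hδ hG hc hlam₁ hε hf hqi (hκ' j) (E := E)
      (κ := κ) (hcar.imp (fun h x hx y hy => (h x hx y hy).trans hle) (fun ⟨h0, h⟩ => ⟨h0,
        fun x hx y hy => by
          obtain ⟨h₁, hh₁, h₂, hh₂, S, hS, ⟨u, hu, hxu⟩, v, hv, hyv⟩ := h x hx y hy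
          exact ⟨h₁, hh₁, h₂, hh₂, S, hS, ⟨u, hu, hxu.trans hle⟩, v, hv, hyv.trans hle⟩⟩))
      (by
        rw [hκ]
        have := le_ciSup (Set.finite_range κ').bddAbove j
        linarith)
      (hγ i).1 (hL0 i) hE0 a (fun s t hs ht => (hsc.wallPiece i j a s t hs ht).le) hxD hyD hx.2 hy.2
    refine h1.trans ?_
    have h2 : 0 ≤ lam₁ * (2 * D) := by positivity
    rw [hQ]
    linarith
  refine ⟨⟨fun i j P hP => ⟨hcone i j P hP, hcone j i P ?_⟩, ?_⟩, fun i U hU _ => hwall i U hU⟩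
  · obtain ⟨h, h', hne, hcomp⟩ := hP
    exact ⟨h', h, hne.symm, by rwa [Set.inter_comm]⟩
  · rintro i P ⟨U, hU, -, rfl, -⟩
    exact hwall i U hU
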